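/- All pentagons are simple (not necessarily convex) pentagons of area 1 in the Euclidean plane; let $a_1,\dots,a_5$ be the interior angles. We say that the angle $a_j$ tiles if there are nonnegative integers $m_1,\dots,m_5$ with $m_j\ge 1$ and $\sum_i m_i a_i = 360^\circ$, and that $a_j$ can tile a degree-four vertex if the $m_i$ can be chosen so that in addition $\sum_i m_i = 4$. Among all unit-area pentagons all five of whose angles tile, with at least one angle that can tile a degree-four vertex, there is one of least perimeter. A pentagon is such a perimeter minimizer if and only if it is a unit-area pentagon that is circumscribed about a circle and whose angles are, in some cyclic order, one angle of $90^\circ$, three angles of $108^\circ$ and one angle of $126^\circ$. The least perimeter is approximately $3.8414$ (correct to four decimal places). -/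

import Mathlib

namespace PentagonTiling

open scoped Affine ComplexConjugate

/-- A pentagon in the Euclidean plane `ℂ`, given by its vertices in cyclic order, is simple if two
consecutive edges meet only in their common vertex and two nonconsecutive edges are disjoint.
(In particular the five vertices are distinct. Nonconvex pentagons are allowed.) -/
structure IsSimple (P : Polygon ℂ 5) : Prop where
  consecutive : ∀ i : Fin 5, P.edgeSet ℝ i ∩ P.edgeSet ℝ (i + 1) = {P (i + 1)}
  nonconsecutive : ∀ i j : Fin 5, j ≠ i → j ≠ i + 1 → i ≠ j + 1 →
    Disjoint (P.edgeSet ℝ i) (P.edgeSet ℝ j)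

/-- The signed area of a closed pentagon (shoelace formula). For a simple pentagon it is the
enclosed area if the vertices are labelled counterclockwise, and minus the enclosed area if they
are labelled clockwise. -/
noncomputable def signedArea (P : Polygon ℂ 5) : ℝ :=
  (∑ i : Fin 5, (conj (P i) * P (i + 1)).im) / 2

/-- The pentagon is simple, its vertices are labelled counterclockwise, and it has unit area. -/
structure IsUnitPentagon (P : Polygon ℂ 5) : Prop where
  simple : IsSimple P
  area : signedArea P = 1

/-- The perimeter. -/
noncomputable def perimeter (P : Polygon ℂ 5) : ℝ :=
  ∑ i : Fin 5, dist (P i) (P (i + 1))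

/-- The interior angle at the `i`-th vertex, in `[0, 2π)`, of a simple pentagon labelled
counterclockwise: the angle of the counterclockwise rotation that takes the direction of the
outgoing edge to the direction of the incoming edge reversed. It exceeds `π` at a reflex vertex. -/
noncomputable def interiorAngle (P : Polygon ℂ 5) (i : Fin 5) : ℝ :=
  toIcoMod Real.two_pi_pos 0 (Complex.arg ((P (i - 1) - P i) / (P (i + 1) - P i)))

/-- The `j`-th angle tiles: angles from the list `a`, repetitions allowed and `a j` among them,
sum to `2π`. Here `m i` is the number of times that `a i` is used. -/
def AngleTiles (a : Fin 5 → ℝ) (j : Fin 5) : Prop :=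
  ∃ m : Fin 5 → ℕ, 0 < m j ∧ ∑ i, (m i : ℝ) * a i = 2 * Real.pi

/-- The `j`-th angle can tile a vertex of degree four: exactly four angles from the list `a`,
repetitions allowed and `a j` among them, sum to `2π`. -/
def AngleTilesDegreeFour (a : Fin 5 → ℝ) (j : Fin 5) : Prop :=
  ∃ m : Fin 5 → ℕ, 0 < m j ∧ ∑ i, m i = 4 ∧ ∑ i, (m i : ℝ) * a i = 2 * Real.pi

/-- The pentagon is circumscribed about a circle: each of its edges is tangent to one common circle,
at a point of that edge. -/
def IsCircumscribed (P : Polygon ℂ 5) : Prop :=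
  ∃ s : EuclideanGeometry.Sphere ℂ, 0 < s.radius ∧
    ∀ i : Fin 5, ∃ t ∈ P.edgeSet ℝ i, s.IsTangentAt t line[ℝ, P i, P (i + 1)]

/-- The competitors: unit-area pentagons all five of whose angles tile, at least one of them being
able to tile a vertex of degree four. -/
structure IsCompetitor (P : Polygon ℂ 5) : Prop extends IsUnitPentagon P where
  tiles : ∀ j, AngleTiles (interiorAngle P) j
  tiles_four : ∃ j, AngleTilesDegreeFour (interiorAngle P) j

/-- A competitor of least perimeter. -/
structure IsPerimeterMinimizer (P : Polygon ℂ 5) : Prop extends IsCompetitor P where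
  le_perimeter : ∀ Q : Polygon ℂ 5, IsCompetitor Q → perimeter P ≤ perimeter Q

end PentagonTiling

/-! For a convex pentagon with angles a_i, Lhuilier's inequality L² ≥ 4A ∑ cot(a_i/2) holds, with
equality exactly in the circumscribed case. At unit area it remains to minimize ∑ cot(a_i/2) over
angles with sum 3π that satisfy the tiling conditions. For `lhuilier`, subtract s times the polygon
about the unit circle with the same edge directions: the signed area becomes A - sL + s² ∑
cot(a_i/2), and for a suitable s the difference degenerates into two triangles of nonpositive area
(`area_nonpos_of_degenerate`). So the discriminant is nonnegative.

A vertex that is not a strict left turn can be deleted, and the isoperimetric inequality for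
quadrilaterals gives L ≥ 4, which is too long. Otherwise the angle sum is π or 3π, and simplicity
excludes π.

The angle problem is `minCotSum_le`. Near the minimum, tangent lines to the convex function cot(x/2)
show that a degree-four vertex forces a right angle and that the other angles exceed it. The second
smallest angle can then tile only in a triple, so the largest is at least 7π/10; convexity now
singles out the extremal angles. `exists_circumscribed` realizes them. -/

namespace PentagonTiling

open scoped Affine ComplexConjugate

/-! ### Cross products and pentagons with a nonconvex vertex -/

/-- The cross product of two plane vectors. -/
def cross (z w : ℂ) : ℝ := z.re * w.im - z.im * w.re

/-- Twice the signed area of the triangle `abc`. -/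
def orient (a b c : ℂ) : ℝ := cross (b - a) (c - a)

lemma im_conj_mul (z w : ℂ) : (conj z * w).im = cross z w := by
  simp [cross]; ring

lemma cross_le_norm_mul_norm (z w : ℂ) : cross z w ≤ ‖z‖ * ‖w‖ := by
  rw [← im_conj_mul]
  calc (conj z * w).im ≤ ‖conj z * w‖ := (le_abs_self _).trans (Complex.abs_im_le_norm _)
    _ = ‖z‖ * ‖w‖ := by simp

lemma sum_fin_five_shift {M : Type*} [AddCommMonoid M] (f : Fin 5 → M) (k : Fin 5) :
    ∑ i, f i = f k + f (k + 1) + f (k + 2) + f (k + 3) + f (k + 4) := by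
  rw [← Equiv.sum_comp (Equiv.addLeft k) f, Fin.sum_univ_five]
  simp

lemma signedArea_eq (P : Polygon ℂ 5) (k : Fin 5) :
    signedArea P = (cross (P k) (P (k + 1)) + cross (P (k + 1)) (P (k + 2)) +
      cross (P (k + 2)) (P (k + 3)) + cross (P (k + 3)) (P (k + 4)) +
      cross (P (k + 4)) (P k)) / 2 := by
  rw [signedArea, sum_fin_five_shift _ k]
  simp only [im_conj_mul, add_assoc k, Fin.reduceAdd, add_zero]

lemma perimeter_eq (P : Polygon ℂ 5) (k : Fin 5) :
    perimeter P = dist (P k) (P (k + 1)) + dist (P (k + 1)) (P (k + 2)) +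
      dist (P (k + 2)) (P (k + 3)) + dist (P (k + 3)) (P (k + 4)) + dist (P (k + 4)) (P k) := by
  rw [perimeter, sum_fin_five_shift _ k]
  simp only [add_assoc]
  congr
  fin_cases k <;> rfl

/-- Isoperimetric inequality for closed quadrilaterals. -/
lemma quadrilateral_isoperimetric (a b c d : ℂ) :
    8 * (cross a b + cross b c + cross c d + cross d a) ≤
      (dist a b + dist b c + dist c d + dist d a) ^ 2 := by
  have h1 := cross_le_norm_mul_norm (b - a) (c - b)
  have h2 := cross_le_norm_mul_norm (d - c) (a - d)
  have h3 := cross_le_norm_mul_norm (c - b) (d - c)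
  have h4 := cross_le_norm_mul_norm (a - d) (b - a)
  rw [← dist_eq_norm, ← dist_eq_norm] at h1 h2 h3 h4
  rw [dist_comm b a, dist_comm c b] at h1
  rw [dist_comm d c, dist_comm a d] at h2
  rw [dist_comm c b, dist_comm d c] at h3
  rw [dist_comm a d, dist_comm b a] at h4
  have e : 2 * (cross a b + cross b c + cross c d + cross d a) =
      cross (b - a) (c - b) + cross (d - c) (a - d) + cross (c - b) (d - c) +
        cross (a - d) (b - a) := by
    simp only [cross, Complex.sub_re, Complex.sub_im]; ring
  -- The four corner bounds add up to (ab + cd)(bc + da), and AM–GM finishes.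
  nlinarith [sq_nonneg (dist a b + dist c d - dist b c - dist d a)]

/-- A unit-area closed pentagon with a vertex that is not strictly convex has perimeter at least
that of the unit square. -/
lemma four_le_perimeter {P : Polygon ℂ 5} (hA : signedArea P = 1) {k : Fin 5}
    (hk : orient (P k) (P (k + 1)) (P (k + 2)) ≤ 0) : 4 ≤ perimeter P := by
  have h := quadrilateral_isoperimetric (P k) (P (k + 2)) (P (k + 3)) (P (k + 4))
  have ht := dist_triangle (P k) (P (k + 1)) (P (k + 2))
  rw [signedArea_eq P k] at hA
  rw [perimeter_eq P k]
  -- Deleting `P (k + 1)` subtracts this orientation from twice the signed area, hence does not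
  -- decrease it; nor does it lengthen the boundary.
  have e : orient (P k) (P (k + 1)) (P (k + 2)) = cross (P k) (P (k + 1)) +
      cross (P (k + 1)) (P (k + 2)) - cross (P k) (P (k + 2)) := by
    simp only [orient, cross, Complex.sub_re, Complex.sub_im]; ring
  have h16 : (4 : ℝ) ^ 2 ≤ (dist (P k) (P (k + 2)) + dist (P (k + 2)) (P (k + 3)) +
      dist (P (k + 3)) (P (k + 4)) + dist (P (k + 4)) (P k)) ^ 2 := by linarith
  have := abs_le_of_sq_le_sq' h16 (by positivity)
  linarith [this.2]

/-! ### Consequences of simplicity -/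

lemma edgeSet_eq (P : Polygon ℂ 5) (i : Fin 5) :
    P.edgeSet ℝ i = affineSegment ℝ (P i) (P (i + 1)) := by
  simp [Polygon.edgeSet]

lemma mem_edgeSet {P : Polygon ℂ 5} {i : Fin 5} {x : ℂ} :
    x ∈ P.edgeSet ℝ i ↔ ∃ r : ℝ, 0 ≤ r ∧ r ≤ 1 ∧ x = P i + r * (P (i + 1) - P i) := by
  rw [edgeSet_eq, affineSegment]
  constructor
  · rintro ⟨r, hr, rfl⟩
    exact ⟨r, hr.1, hr.2, by simp [AffineMap.lineMap_apply]; ring⟩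
  · rintro ⟨r, h0, h1, rfl⟩
    exact ⟨r, ⟨h0, h1⟩, by simp [AffineMap.lineMap_apply]; ring⟩

/-- If `a`, `b` lie on different sides of the line `cd` and vice versa, then the segments meet. -/
lemma exists_common_point {a b c d : ℂ} (h1 : 0 < orient a b c) (h2 : orient a b d ≤ 0)
    (h3 : 0 < orient c d b) (h4 : orient c d a ≤ 0) :
    ∃ r s : ℝ, (0 ≤ r ∧ r ≤ 1) ∧ (0 ≤ s ∧ s ≤ 1) ∧ a + r * (b - a) = c + s * (d - c) := by
  have hD : 0 < orient a b c - orient a b d := by linarith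
  have hD' : orient c d b - orient c d a = orient a b c - orient a b d := by
    simp only [orient, cross, Complex.sub_re, Complex.sub_im]; ring
  refine ⟨-orient c d a / (orient a b c - orient a b d),
    orient a b c / (orient a b c - orient a b d), ⟨?_, ?_⟩, ⟨?_, ?_⟩, ?_⟩
  · exact div_nonneg (by linarith) hD.le
  · rw [div_le_one hD]; linarith
  · exact div_nonneg h1.le hD.le
  · rw [div_le_one hD]; linarith
  · apply Complex.ext <;>
    · simp only [Complex.add_re, Complex.add_im, Complex.re_ofReal_mul, Complex.im_ofReal_mul,
        Complex.sub_re, Complex.sub_im]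
      field_simp
      simp only [orient, cross, Complex.sub_re, Complex.sub_im]; ring

/-- Otherwise the edges `i` and `i + 2` separate each other's endpoints and meet by
`exists_common_point`, although they are not consecutive. -/
lemma IsSimple.orient_pos_or {P : Polygon ℂ 5} (hP : IsSimple P)
    (hc : ∀ i, 0 < orient (P i) (P (i + 1)) (P (i + 2))) (i : Fin 5) :
    0 < orient (P i) (P (i + 1)) (P (i + 3)) ∨
      0 < orient (P (i + 2)) (P (i + 3)) (P i) := by
  by_contra! h
  have h3 : 0 < orient (P (i + 2)) (P (i + 3)) (P (i + 1)) := by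
    have := hc (i + 1)
    simp only [add_assoc, Fin.reduceAdd] at this
    refine this.trans_eq ?_
    simp only [orient, cross, Complex.sub_re, Complex.sub_im]; ring
  obtain ⟨r, s, hr, hs, e⟩ := exists_common_point (hc i) h.1 h3 h.2
  have hd := hP.nonconsecutive i (i + 2) (by fin_cases i <;> decide) (by fin_cases i <;> decide)
    (by fin_cases i <;> decide)
  refine Set.disjoint_left.1 hd (mem_edgeSet.2 ⟨r, hr.1, hr.2, rfl⟩)
    (mem_edgeSet.2 ⟨s, hs.1, hs.2, ?_⟩)
  rw [e, show i + 2 + 1 = i + 3 by fin_cases i <;> rfl]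

/-- A Grassmann–Plücker relation. -/
lemma orient_plucker (a b c d e : ℂ) :
    orient a b d * orient e a c =
      orient a b c * orient d e a + orient e a b * orient c d a := by
  simp only [orient, cross, Complex.sub_re, Complex.sub_im]; ring

/-- In a simple locally strictly convex pentagon two consecutive exterior angles have sum less
than `π`, for some pair. -/
lemma IsSimple.exists_lt_orient {P : Polygon ℂ 5} (hP : IsSimple P)
    (hc : ∀ i, 0 < orient (P i) (P (i + 1)) (P (i + 2))) :
    ∃ i, orient (P i) (P (i + 1)) (P (i + 2)) < orient (P i) (P (i + 1)) (P (i + 3)) := by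
  by_contra! h
  -- The right side of the Plücker relation is positive, so the factors on the left have equal
  -- signs. Were both positive, the negated goal would bound their product by the first term on the
  -- right alone.
  have pl : ∀ i : Fin 5, 0 < orient (P (i + 2)) (P (i + 3)) (P i) →
      orient (P i) (P (i + 1)) (P (i + 3)) < 0 ∧ orient (P (i + 4)) (P i) (P (i + 2)) < 0 := by
    intro i hi
    have e := orient_plucker (P i) (P (i + 1)) (P (i + 2)) (P (i + 3)) (P (i + 4))
    have c0 := hc i
    have c3 := hc (i + 3)
    have c4 := hc (i + 4)
    have s0 := h i
    have s4 := h (i + 4)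
    simp only [add_assoc, Fin.reduceAdd, add_zero] at c3
    simp only [add_assoc, Fin.reduceAdd, add_zero] at c4
    simp only [add_assoc, Fin.reduceAdd, add_zero] at s4
    have s4' : orient (P (i + 4)) (P i) (P (i + 2)) ≤ orient (P (i + 3)) (P (i + 4)) (P i) := by
      have h3 := h (i + 2)
      simp only [add_assoc, Fin.reduceAdd, add_zero] at h3
      have id1 : orient (P (i + 4)) (P i) (P (i + 2)) - orient (P (i + 3)) (P (i + 4)) (P i) =
          orient (P (i + 2)) (P (i + 3)) (P i) - orient (P (i + 2)) (P (i + 3)) (P (i + 4)) := by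
        simp only [orient, cross, Complex.sub_re, Complex.sub_im]; ring
      linarith
    have hpos : 0 < orient (P i) (P (i + 1)) (P (i + 3)) *
        orient (P (i + 4)) (P i) (P (i + 2)) := by
      rw [e]; positivity
    rcases pos_and_pos_or_neg_and_neg_of_mul_pos hpos with hh | hh
    · nlinarith [mul_pos c4 hi]
    · exact hh
  -- Negativity propagates: non-crossing turns it into the hypothesis of `pl` at `i + 4`, and then
  -- into positivity of an orientation already known to be negative.
  have key : ∀ i : Fin 5, ¬ 0 < orient (P (i + 2)) (P (i + 3)) (P i) := by
    intro i hi
    obtain ⟨n0, n4⟩ := pl i hi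
    have p1 := (hP.orient_pos_or hc (i + 4))
    simp only [add_assoc, Fin.reduceAdd, add_zero] at p1
    have p1' := p1.resolve_left n4.not_gt
    have := pl (i + 4)
    simp only [add_assoc, Fin.reduceAdd, add_zero] at this
    obtain ⟨-, n3⟩ := this p1'
    have p3 := (hP.orient_pos_or hc (i + 3))
    simp only [add_assoc, Fin.reduceAdd, add_zero] at p3
    have p3' := p3.resolve_left n3.not_gt
    linarith
  rcases hP.orient_pos_or hc 0 with h0 | h0
  · refine key 3 ?_
    simpa only [Fin.reduceAdd] using h0
  · exact key 0 h0

/-! ### Edge directions and the angle sum -/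

/-- All vertices of the pentagon, traversed in order, are strict left turns. -/
def LocallyConvex (P : Polygon ℂ 5) : Prop :=
  ∀ i, 0 < orient (P i) (P (i + 1)) (P (i + 2))

/-- The direction of the `i`-th edge. -/
noncomputable def dir (P : Polygon ℂ 5) (i : Fin 5) : ℂ :=
  (P (i + 1) - P i) / (dist (P i) (P (i + 1)) : ℝ)

lemma div_im_eq_cross (v w : ℂ) : (-v / w).im = cross v w / Complex.normSq w := by
  simp [Complex.div_im, cross]; ring

lemma arg_mem_Ioo_iff {z : ℂ} : Complex.arg z ∈ Set.Ioo 0 Real.pi ↔ 0 < z.im := by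
  constructor
  · rintro ⟨h0, h1⟩
    have h := Real.sin_pos_of_pos_of_lt_pi h0 h1
    rw [Complex.sin_arg] at h
    by_contra! hz
    exact absurd h (not_lt.2 (div_nonpos_of_nonpos_of_nonneg hz (norm_nonneg _)))
  · intro h
    have h0 : 0 ≤ Complex.arg z := Complex.arg_nonneg_iff.2 h.le
    refine ⟨h0.lt_of_ne' fun he ↦ ?_, Complex.arg_lt_pi_iff.2 (Or.inr h.ne')⟩
    exact h.ne' (Complex.arg_eq_zero_iff.1 he).2

lemma toIcoMod_arg_mem_Ioo_iff {z : ℂ} :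
    toIcoMod Real.two_pi_pos 0 (Complex.arg z) ∈ Set.Ioo 0 Real.pi ↔ 0 < z.im := by
  have hπ := Real.pi_pos
  rcases le_or_gt 0 z.im with h | h
  · have : toIcoMod Real.two_pi_pos 0 (Complex.arg z) = Complex.arg z := by
      rw [toIcoMod_eq_self]
      exact ⟨Complex.arg_nonneg_iff.2 h, by linarith [Complex.arg_le_pi z]⟩
    rw [this, arg_mem_Ioo_iff]
  · have : toIcoMod Real.two_pi_pos 0 (Complex.arg z) = Complex.arg z + 2 * Real.pi := by
      rw [toIcoMod_eq_iff]
      refine ⟨⟨by linarith [Complex.neg_pi_lt_arg z], ?_⟩, -1, by simp⟩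
      linarith [Complex.arg_neg_iff.2 h]
    rw [this]
    refine ⟨fun h' ↦ ?_, fun h' ↦ absurd h' h.not_gt⟩
    linarith [h'.2, Complex.neg_pi_lt_arg z]

lemma interiorAngle_succ (P : Polygon ℂ 5) (i : Fin 5) :
    interiorAngle P (i + 1) = toIcoMod Real.two_pi_pos 0
      (Complex.arg (-(P (i + 1) - P i) / (P (i + 2) - P (i + 1)))) := by
  rw [interiorAngle, add_sub_cancel_right, neg_sub]
  simp only [add_assoc, Fin.reduceAdd]

lemma orient_eq_cross (a b c : ℂ) : orient a b c = cross (b - a) (c - b) := by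
  simp only [orient, cross, Complex.sub_re, Complex.sub_im]; ring

lemma interiorAngle_mem_Ioo_iff {P : Polygon ℂ 5} {i : Fin 5} :
    interiorAngle P (i + 1) ∈ Set.Ioo 0 Real.pi ↔
      0 < orient (P i) (P (i + 1)) (P (i + 2)) := by
  rw [interiorAngle_succ, toIcoMod_arg_mem_Ioo_iff, div_im_eq_cross, orient_eq_cross]
  constructor
  · intro h
    by_contra! hc
    exact absurd h (not_lt.2 (div_nonpos_of_nonpos_of_nonneg hc (Complex.normSq_nonneg _)))
  · intro h
    refine div_pos h (Complex.normSq_pos.2 fun h0 ↦ ?_)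
    simp [h0, cross] at h

lemma locallyConvex_iff {P : Polygon ℂ 5} :
    LocallyConvex P ↔ ∀ i, interiorAngle P i ∈ Set.Ioo 0 Real.pi := by
  refine ⟨fun h i ↦ ?_, fun h i ↦ interiorAngle_mem_Ioo_iff.1 (h _)⟩
  have := interiorAngle_mem_Ioo_iff.2 (h (i - 1))
  rwa [sub_add_cancel] at this

namespace LocallyConvex

variable {P : Polygon ℂ 5} (h : LocallyConvex P)
include h

lemma dist_pos (i : Fin 5) : 0 < dist (P i) (P (i + 1)) := by
  refine _root_.dist_pos.2 fun e ↦ ?_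
  have := h i
  simp [orient, cross, e] at this

lemma edge_eq (i : Fin 5) : P (i + 1) - P i = (dist (P i) (P (i + 1)) : ℝ) * dir P i := by
  have : ((dist (P i) (P (i + 1)) : ℝ) : ℂ) ≠ 0 := by exact_mod_cast (h.dist_pos i).ne'
  rw [dir]; field_simp

lemma norm_dir (i : Fin 5) : ‖dir P i‖ = 1 := by
  rw [dir, norm_div, Complex.norm_real, Real.norm_eq_abs, abs_of_pos (h.dist_pos i),
    ← dist_eq_norm, dist_comm, div_self (h.dist_pos i).ne']

lemma dir_ne_zero (i : Fin 5) : dir P i ≠ 0 := by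
  have := h.norm_dir i
  rintro e
  simp [e] at this

/-- Each edge turns left from its predecessor by π minus the interior angle. -/
lemma dir_succ (i : Fin 5) :
    dir P (i + 1) = -dir P i * Complex.exp (-(interiorAngle P (i + 1) * Complex.I)) := by
  have hd := h.dist_pos i
  have hd' := h.dist_pos (i + 1)
  have e := h.edge_eq i
  have e' := h.edge_eq (i + 1)
  have hz := interiorAngle_mem_Ioo_iff.2 (h i)
  simp only [add_assoc, Fin.reduceAdd] at hd' e'
  rw [interiorAngle_succ] at hz ⊢
  set z := -(P (i + 1) - P i) / (P (i + 2) - P (i + 1)) with hzdef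
  rw [toIcoMod_arg_mem_Ioo_iff] at hz
  have ha := arg_mem_Ioo_iff.2 hz
  have : toIcoMod Real.two_pi_pos 0 (Complex.arg z) = Complex.arg z := by
    rw [toIcoMod_eq_self]
    exact ⟨ha.1.le, by linarith [ha.2, Real.pi_pos]⟩
  rw [this]
  have hz2 := Complex.norm_mul_exp_arg_mul_I z
  have hn : ‖z‖ = dist (P i) (P (i + 1)) / dist (P (i + 1)) (P (i + 2)) := by
    rw [hzdef, norm_div, norm_neg, ← dist_eq_norm, ← dist_eq_norm, dist_comm,
      dist_comm (P (i + 2))]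
  have c1 : ((dist (P i) (P (i + 1)) : ℝ) : ℂ) ≠ 0 := by exact_mod_cast hd.ne'
  have c2 : ((dist (P (i + 1)) (P (i + 2)) : ℝ) : ℂ) ≠ 0 := by exact_mod_cast hd'.ne'
  have c3 := h.dir_ne_zero (i + 1)
  have c4 := Complex.exp_ne_zero (Complex.arg z * Complex.I)
  rw [hn] at hz2
  replace hz2 := hz2.trans (hzdef.trans (by rw [e, e']))
  rw [Complex.exp_neg]
  push_cast at hz2
  field_simp at hz2 ⊢
  linear_combination hz2

lemma cross_dir (i : Fin 5) : cross (dir P i) (dir P (i + 2)) =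
    -Real.sin (interiorAngle P (i + 1) + interiorAngle P (i + 2)) := by
  have e1 := h.dir_succ i
  have e2 := h.dir_succ (i + 1)
  simp only [add_assoc, Fin.reduceAdd] at e2
  have e3 : conj (dir P i) * dir P i = 1 := by
    rw [Complex.conj_mul', h.norm_dir]; simp
  have e4 : conj (dir P i) * dir P (i + 2) =
      Complex.exp ((-(interiorAngle P (i + 1) + interiorAngle P (i + 2)) : ℝ) * Complex.I) := by
    rw [e2, e1]
    push_cast
    rw [neg_add, add_mul, Complex.exp_add]
    simp only [neg_mul]
    linear_combination (Complex.exp (-(interiorAngle P (i + 1) * Complex.I)) *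
      Complex.exp (-(interiorAngle P (i + 2) * Complex.I))) * e3
  rw [← im_conj_mul, e4, Complex.exp_ofReal_mul_I_im, Real.sin_neg]

/-- The five turns compose to the identity, so the sum is an odd multiple of π, and it lies strictly
between 0 and 5π. The value π is that of a pentagram. -/
lemma sum_interiorAngle_eq_pi_or :
    ∑ i, interiorAngle P i = Real.pi ∨ ∑ i, interiorAngle P i = 3 * Real.pi := by
  have hprod : Complex.exp (-(((∑ i, interiorAngle P i : ℝ) : ℂ) * Complex.I)) = -1 := by
    have h0 := h.dir_succ 0
    have h1 := h.dir_succ 1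
    have h2 := h.dir_succ 2
    have h3 := h.dir_succ 3
    have h4 := h.dir_succ 4
    simp only [Fin.reduceAdd, zero_add] at h0 h1 h2 h3 h4
    rw [h3, h2, h1, h0] at h4
    have hne := h.dir_ne_zero 0
    rw [Fin.sum_univ_five]
    push_cast
    rw [← mul_right_inj' hne, add_mul, add_mul, add_mul, add_mul]
    simp only [neg_add, Complex.exp_add]
    linear_combination h4
  have hcos : Real.cos (∑ i, interiorAngle P i - Real.pi) = 1 := by
    have := congrArg Complex.re hprod
    rw [← neg_mul, ← Complex.ofReal_neg, Complex.exp_ofReal_mul_I_re, Real.cos_neg] at this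
    rw [Real.cos_sub_pi, this]; simp
  obtain ⟨n, hn⟩ := (Real.cos_eq_one_iff _).1 hcos
  have hi := locallyConvex_iff.1 h
  have hπ := Real.pi_pos
  have hlo : 0 < ∑ i, interiorAngle P i := Finset.sum_pos (fun i _ ↦ (hi i).1) ⟨0, by simp⟩
  have hhi : ∑ i, interiorAngle P i < 5 * Real.pi := by
    rw [Fin.sum_univ_five]
    linarith [(hi 0).2, (hi 1).2, (hi 2).2, (hi 3).2, (hi 4).2]
  have n0 : -1 < n := by
    have : (-1 : ℝ) < n := by nlinarith
    exact_mod_cast this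
  have n2 : n < 2 := by
    have : (n : ℝ) < 2 := by nlinarith
    exact_mod_cast this
  have : n = 0 ∨ n = 1 := by omega
  rcases this with rfl | rfl
  · left; push_cast at hn; linarith
  · right; push_cast at hn; linarith

/-- Simplicity supplies two neighbouring angles whose sum has negative sine; a total of π leaves no
room for such a pair. -/
lemma sum_interiorAngle (hs : IsSimple P) : ∑ i, interiorAngle P i = 3 * Real.pi := by
  refine h.sum_interiorAngle_eq_pi_or.resolve_left fun hsum ↦ ?_
  obtain ⟨i, hlt⟩ := hs.exists_lt_orient h
  have e0 := h.edge_eq i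
  have e2 := h.edge_eq (i + 2)
  simp only [add_assoc, Fin.reduceAdd] at e2
  have e : orient (P i) (P (i + 1)) (P (i + 3)) - orient (P i) (P (i + 1)) (P (i + 2)) =
      cross (P (i + 1) - P i) (P (i + 3) - P (i + 2)) := by
    simp only [orient, cross, Complex.sub_re, Complex.sub_im]; ring
  have e' : cross (P (i + 1) - P i) (P (i + 3) - P (i + 2)) = dist (P i) (P (i + 1)) *
      dist (P (i + 2)) (P (i + 3)) * cross (dir P i) (dir P (i + 2)) := by
    rw [e0, e2]
    simp only [cross, Complex.re_ofReal_mul, Complex.im_ofReal_mul]; ring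
  rw [e', h.cross_dir] at e
  have hd := h.dist_pos i
  have hd' := h.dist_pos (i + 2)
  simp only [add_assoc, Fin.reduceAdd] at hd'
  have hi := locallyConvex_iff.1 h
  have hle : interiorAngle P (i + 1) + interiorAngle P (i + 2) ≤ Real.pi := by
    rw [← hsum, sum_fin_five_shift _ i]
    linarith [(hi i).1, (hi (i + 3)).1, (hi (i + 4)).1]
  have hsin := Real.sin_nonneg_of_nonneg_of_le_pi
    (add_nonneg (hi (i + 1)).1.le (hi (i + 2)).1.le) hle
  nlinarith [mul_nonneg (mul_pos hd hd').le hsin]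

end LocallyConvex

/-! ### Lhuilier's inequality -/

/-- A closed pentagon with prescribed edge directions in which the triangle cut out by the lines of
the edges `0`, `2`, `4` is degenerate has nonpositive area, and zero area only if it is a point. -/
lemma area_nonpos_of_degenerate {r u : Fin 5 → ℂ} {m : Fin 5 → ℝ} {k : Fin 5}
    (hr : ∀ i, r (i + 1) - r i = m i * u i)
    (hu : ∀ i, 0 < cross (u i) (u (i + 1)))
    (h02 : 0 < cross (u k) (u (k + 2))) (h24 : 0 < cross (u (k + 2)) (u (k + 4)))
    (hm : m k * cross (u k) (u (k + 2)) + m (k + 1) * cross (u (k + 1)) (u (k + 2)) = 0) :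
    signedArea ⟨r⟩ ≤ 0 ∧ (signedArea ⟨r⟩ = 0 → ∀ i, m i = 0) := by
  have e0 := hr k
  have e1 := hr (k + 1)
  have e2 := hr (k + 2)
  have e3 := hr (k + 3)
  have e4 := hr (k + 4)
  have u0 := hu k
  have u1 := hu (k + 1)
  have u2 := hu (k + 2)
  have u3 := hu (k + 3)
  simp only [add_assoc, Fin.reduceAdd, add_zero] at e1 e2 e3 e4 u1 u2 u3
  have hsum : (m k : ℂ) * u k + m (k + 1) * u (k + 1) + m (k + 2) * u (k + 2) +
      m (k + 3) * u (k + 3) + m (k + 4) * u (k + 4) = 0 := by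
    rw [← e0, ← e1, ← e2, ← e3, ← e4]; ring
  have hre := congrArg Complex.re hsum
  have him := congrArg Complex.im hsum
  simp only [Complex.add_re, Complex.add_im, Complex.re_ofReal_mul, Complex.im_ofReal_mul,
    Complex.zero_re, Complex.zero_im] at hre him
  -- By `hm`, `r k` lies on the line through `r (k + 2)` of direction `u (k + 2)`. Closing up gives
  -- the same relation on the other side, and the pentagon splits into two triangles with common
  -- vertex `r k`.
  have hm' : m (k + 3) * cross (u (k + 2)) (u (k + 3)) +
      m (k + 4) * cross (u (k + 2)) (u (k + 4)) = 0 := by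
    rw [← hm]
    simp only [cross]
    linear_combination (u (k + 2)).re * him - (u (k + 2)).im * hre
  have harea : 2 * signedArea ⟨r⟩ = m k * m (k + 1) * cross (u k) (u (k + 1)) +
      m (k + 3) * m (k + 4) * cross (u (k + 3)) (u (k + 4)) := by
    have h1 : 2 * signedArea ⟨r⟩ = cross (r (k + 1) - r k) (r (k + 2) - r (k + 1)) +
        (cross (r (k + 1) - r k) (r (k + 3) - r (k + 2)) +
          cross (r (k + 2) - r (k + 1)) (r (k + 3) - r (k + 2))) +
        cross (r (k + 4) - r (k + 3)) (r k - r (k + 4)) := by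
      rw [signedArea_eq _ k]
      simp only [cross, Complex.sub_re, Complex.sub_im]; ring
    have h2 : ∀ (a b : ℝ) (z w : ℂ), cross (a * z) (b * w) = a * b * cross z w := by
      intro a b z w
      simp only [cross, Complex.re_ofReal_mul, Complex.im_ofReal_mul]; ring
    rw [h1, e0, e1, e2, e3, e4, h2, h2, h2, h2]
    linear_combination m (k + 2) * hm
  -- Solving for one side of each triangle in terms of the other makes its area a negative multiple
  -- of a square.
  have hk : m k = -(m (k + 1) * cross (u (k + 1)) (u (k + 2))) / cross (u k) (u (k + 2)) := by
    field_simp; linarith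
  have hk4 : m (k + 4) =
      -(m (k + 3) * cross (u (k + 2)) (u (k + 3))) / cross (u (k + 2)) (u (k + 4)) := by
    field_simp; linarith
  have harea' : 2 * signedArea ⟨r⟩ =
      -(m (k + 1) ^ 2 * (cross (u (k + 1)) (u (k + 2)) * cross (u k) (u (k + 1)) /
          cross (u k) (u (k + 2))) +
        m (k + 3) ^ 2 * (cross (u (k + 2)) (u (k + 3)) * cross (u (k + 3)) (u (k + 4)) /
          cross (u (k + 2)) (u (k + 4)))) := by
    rw [harea, hk, hk4]; field_simp; ring
  have c1 : 0 < cross (u (k + 1)) (u (k + 2)) * cross (u k) (u (k + 1)) /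
      cross (u k) (u (k + 2)) := by positivity
  have c2 : 0 < cross (u (k + 2)) (u (k + 3)) * cross (u (k + 3)) (u (k + 4)) /
      cross (u (k + 2)) (u (k + 4)) := by positivity
  have p1 := mul_nonneg (sq_nonneg (m (k + 1))) c1.le
  have p2 := mul_nonneg (sq_nonneg (m (k + 3))) c2.le
  refine ⟨by linarith, fun h0 ↦ ?_⟩
  have z1 : m (k + 1) = 0 := by
    have : m (k + 1) ^ 2 = 0 :=
      (mul_eq_zero.1 (by linarith : m (k + 1) ^ 2 * _ = 0)).resolve_right c1.ne'
    simpa using this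
  have z3 : m (k + 3) = 0 := by
    have : m (k + 3) ^ 2 = 0 :=
      (mul_eq_zero.1 (by linarith : m (k + 3) ^ 2 * _ = 0)).resolve_right c2.ne'
    simpa using this
  have z0 : m k = 0 := by rw [hk, z1]; simp
  have z4 : m (k + 4) = 0 := by rw [hk4, z3]; simp
  have z2 : m (k + 2) = 0 := by
    rw [z0, z1, z3, z4] at hre him
    have : m (k + 2) * cross (u (k + 2)) (u (k + 4)) = 0 := by
      simp only [cross]
      linear_combination (u (k + 4)).im * hre - (u (k + 4)).re * him
    exact (mul_eq_zero.1 this).resolve_right h24.ne'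
  intro i
  have hcases : ∀ i k : Fin 5, i = k ∨ i = k + 1 ∨ i = k + 2 ∨ i = k + 3 ∨ i = k + 4 := by
    decide
  rcases hcases i k with rfl | rfl | rfl | rfl | rfl <;> assumption

/-- The cotangents of the half-angles of a pentagon. -/
noncomputable def cotHalf (P : Polygon ℂ 5) (i : Fin 5) : ℝ := Real.cot (interiorAngle P i / 2)

/-- The polygon circumscribed about the unit circle with the edge directions of `P`. -/
noncomputable def tangential (P : Polygon ℂ 5) (i : Fin 5) : ℂ :=
  -(Complex.I + cotHalf P i) * dir P i

/-- Here `v` is `u` turned by θ = π - a, and (v - u)/(v + u) = i tan(θ/2). -/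
lemma cot_half_mul_eq {a : ℝ} (ha : a ∈ Set.Ioo 0 Real.pi) {u v : ℂ}
    (h : v = -u * Complex.exp (-(a * Complex.I))) :
    v - u = Complex.I * Real.cot (a / 2) * (v + u) := by
  have hs : Real.sin (a / 2) ≠ 0 :=
    (Real.sin_pos_of_pos_of_lt_pi (by linarith [ha.1]) (by linarith [ha.1, ha.2])).ne'
  have hs' : (Real.sin (a / 2) : ℂ) ≠ 0 := by exact_mod_cast hs
  have hexp : Complex.exp (-(a * Complex.I)) =
      ((Real.cos (a / 2) : ℂ) ^ 2 - (Real.sin (a / 2) : ℂ) ^ 2) -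
        2 * Real.sin (a / 2) * Real.cos (a / 2) * Complex.I := by
    have h2 : -((a : ℂ) * Complex.I) = -(((a / 2 : ℝ) : ℂ)) * Complex.I +
      -(((a / 2 : ℝ) : ℂ)) * Complex.I := by push_cast; ring
    rw [h2, Complex.exp_add, Complex.exp_mul_I, Complex.cos_neg, Complex.sin_neg,
      ← Complex.ofReal_cos, ← Complex.ofReal_sin]
    linear_combination (Real.sin (a / 2) : ℂ) ^ 2 * Complex.I_sq
  have hone : (Real.cos (a / 2) : ℂ) ^ 2 + (Real.sin (a / 2) : ℂ) ^ 2 = 1 := by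
    exact_mod_cast Real.cos_sq_add_sin_sq (a / 2)
  rw [h, hexp, Real.cot_eq_cos_div_sin]
  push_cast at hs' hone ⊢
  field_simp
  generalize Complex.sin (a / 2) = s at *
  generalize Complex.cos (a / 2) = c at *
  linear_combination (u * s + u * c * Complex.I) * hone - 2 * u * s * c ^ 2 * Complex.I_sq

lemma cot_pos {x : ℝ} (h0 : 0 < x) (h1 : x < Real.pi / 2) : 0 < Real.cot x := by
  rw [Real.cot_eq_cos_div_sin]
  exact div_pos (Real.cos_pos_of_mem_Ioo ⟨by linarith, h1⟩)
    (Real.sin_pos_of_pos_of_lt_pi h0 (by linarith))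

lemma signedArea_sub_smul (p q : Fin 5 → ℂ) (s : ℝ) :
    2 * signedArea ⟨fun i ↦ p i - s * q i⟩ = 2 * signedArea ⟨p⟩ -
      s * (∑ i, (cross (q i) (p (i + 1) - p i) + cross (q (i + 1)) (p (i + 1) - p i))) +
        s ^ 2 * (2 * signedArea ⟨q⟩) := by
  simp only [signedArea_eq _ 0, sum_fin_five_shift _ 0, zero_add, Fin.reduceAdd, cross,
    Complex.sub_re, Complex.sub_im, Complex.re_ofReal_mul, Complex.im_ofReal_mul]
  ring

namespace LocallyConvex

variable {P : Polygon ℂ 5} (h : LocallyConvex P)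
include h

lemma cotHalf_pos (i : Fin 5) : 0 < cotHalf P i := by
  have := locallyConvex_iff.1 h i
  exact cot_pos (by linarith [this.1]) (by linarith [this.2])

lemma tangential_edge (i : Fin 5) :
    tangential P (i + 1) - tangential P i =
      ((cotHalf P i + cotHalf P (i + 1) : ℝ) : ℂ) * dir P i := by
  have := cot_half_mul_eq (locallyConvex_iff.1 h (i + 1)) (h.dir_succ i)
  simp only [tangential]
  rw [← cotHalf] at this
  push_cast
  linear_combination -Complex.I * this - cotHalf P (i + 1) * (dir P (i + 1) + dir P i) *
    Complex.I_sq

/-- The edge lines of `tangential P` have distance one from the origin; this turns the mixed term of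
`signedArea_sub_smul` into the perimeter. -/
lemma cross_tangential_dir (i : Fin 5) : cross (tangential P i) (dir P i) = 1 := by
  have hn : (dir P i).re ^ 2 + (dir P i).im ^ 2 = 1 := by
    have := Complex.normSq_eq_norm_sq (dir P i)
    rw [h.norm_dir, Complex.normSq_apply] at this
    linarith
  simp [tangential, cross]
  linear_combination hn

lemma cross_tangential_succ_dir (i : Fin 5) : cross (tangential P (i + 1)) (dir P i) = 1 := by
  rw [← h.cross_tangential_dir i, ← sub_eq_zero]
  have e := h.tangential_edge i
  have : cross (tangential P (i + 1)) (dir P i) - cross (tangential P i) (dir P i) =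
      cross (tangential P (i + 1) - tangential P i) (dir P i) := by
    simp only [cross, Complex.sub_re, Complex.sub_im]; ring
  rw [this, e]
  simp only [cross, Complex.re_ofReal_mul, Complex.im_ofReal_mul]; ring

lemma two_mul_signedArea_tangential :
    2 * signedArea ⟨tangential P⟩ = 2 * ∑ i, cotHalf P i := by
  have hi : ∀ i, cross (tangential P i) (tangential P (i + 1)) =
      cotHalf P i + cotHalf P (i + 1) := by
    intro i
    have : cross (tangential P i) (tangential P (i + 1)) =
        cross (tangential P i) (tangential P (i + 1) - tangential P i) := by
      simp only [cross, Complex.sub_re, Complex.sub_im]; ring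
    have h1 := h.cross_tangential_dir i
    rw [this, h.tangential_edge]
    simp only [cross, Complex.re_ofReal_mul, Complex.im_ofReal_mul] at h1 ⊢
    linear_combination (cotHalf P i + cotHalf P (i + 1)) * h1
  simp only [signedArea, im_conj_mul, hi, Finset.sum_add_distrib]
  have hshift : ∑ i, cotHalf P (i + 1) = ∑ i, cotHalf P i :=
    Equiv.sum_comp (Equiv.addRight (1 : Fin 5)) (cotHalf P)
  rw [hshift]
  ring

lemma signedArea_sub_tangential (s : ℝ) :
    signedArea ⟨fun i ↦ P i - s * tangential P i⟩ =
      signedArea P - s * perimeter P + s ^ 2 * ∑ i, cotHalf P i := by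
  have e := signedArea_sub_smul P.vertices (tangential P) s
  rw [h.two_mul_signedArea_tangential] at e
  have hi : ∀ i, cross (tangential P i) (P (i + 1) - P i) +
      cross (tangential P (i + 1)) (P (i + 1) - P i) = 2 * dist (P i) (P (i + 1)) := by
    intro i
    have h1 := h.cross_tangential_dir i
    have h2 := h.cross_tangential_succ_dir i
    rw [h.edge_eq i]
    simp only [cross, Complex.re_ofReal_mul, Complex.im_ofReal_mul] at h1 h2 ⊢
    linear_combination dist (P i) (P (i + 1)) * (h1 + h2)
  simp only [hi, ← Finset.mul_sum] at e
  rw [← perimeter] at e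
  linarith

lemma cross_dir_succ_pos (i : Fin 5) : 0 < cross (dir P i) (dir P (i + 1)) := by
  have h0 := h i
  have e1 := h.edge_eq (i + 1)
  have d1 := h.dist_pos (i + 1)
  simp only [add_assoc, Fin.reduceAdd] at e1 d1
  rw [orient_eq_cross, h.edge_eq i, e1] at h0
  have : cross ((dist (P i) (P (i + 1)) : ℝ) * dir P i)
      ((dist (P (i + 1)) (P (i + 2)) : ℝ) * dir P (i + 1)) =
      (dist (P i) (P (i + 1)) * dist (P (i + 1)) (P (i + 2))) *
        cross (dir P i) (dir P (i + 1)) := by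
    simp only [cross, Complex.re_ofReal_mul, Complex.im_ofReal_mul]; ring
  rw [this] at h0
  exact pos_of_mul_pos_right h0 (mul_pos (h.dist_pos i) d1).le

lemma cross_dir_pos {i : Fin 5}
    (hi : Real.pi < interiorAngle P (i + 1) + interiorAngle P (i + 2)) :
    0 < cross (dir P i) (dir P (i + 2)) := by
  have ha := locallyConvex_iff.1 h
  rw [h.cross_dir, ← Real.sin_sub_pi]
  exact Real.sin_pos_of_pos_of_lt_pi (by linarith) (by linarith [(ha (i + 1)).2, (ha (i + 2)).2])

/-- Two disjoint pairs of consecutive angles, each with sum greater than `π`. -/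
lemma exists_pi_lt (hsum : ∑ i, interiorAngle P i = 3 * Real.pi) :
    ∃ k, Real.pi < interiorAngle P (k + 1) + interiorAngle P (k + 2) ∧
      Real.pi < interiorAngle P (k + 3) + interiorAngle P (k + 4) := by
  have ha := locallyConvex_iff.1 h
  by_contra! hk
  have h0 := hk 0
  have h1 := hk 1
  have h2 := hk 2
  have h3 := hk 3
  have h4 := hk 4
  simp only [Fin.reduceAdd, zero_add] at h0 h1 h2 h3 h4
  rw [Fin.sum_univ_five] at hsum
  have a0 := (ha 0).2
  have a1 := (ha 1).2
  have a2 := (ha 2).2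
  have a3 := (ha 3).2
  have a4 := (ha 4).2
  by_contra!
  -- If two neighbours sum to at most π, the other three angles sum to at least 2π, so both pairs of
  -- neighbours among them exceed π. This clashes with the five implications.
  rcases le_or_gt (interiorAngle P 1 + interiorAngle P 2) Real.pi with g0 | g0 <;>
  rcases le_or_gt (interiorAngle P 2 + interiorAngle P 3) Real.pi with g1 | g1 <;>
  rcases le_or_gt (interiorAngle P 3 + interiorAngle P 4) Real.pi with g2 | g2 <;>
  rcases le_or_gt (interiorAngle P 4 + interiorAngle P 0) Real.pi with g3 | g3 <;>
  rcases le_or_gt (interiorAngle P 0 + interiorAngle P 1) Real.pi with g4 | g4 <;>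
  first
  | linarith
  | linarith [h0 (by linarith)]
  | linarith [h1 (by linarith)]
  | linarith [h2 (by linarith)]
  | linarith [h3 (by linarith)]
  | linarith [h4 (by linarith)]

/-- The multiplier `s` makes the difference of `P` and `s` times its tangential polygon satisfy `hm`
of `area_nonpos_of_degenerate`; zero area then kills every edge of the difference. -/
lemma exists_quadratic_nonpos (hsum : ∑ i, interiorAngle P i = 3 * Real.pi) :
    ∃ s : ℝ, signedArea P - s * perimeter P + s ^ 2 * ∑ i, cotHalf P i ≤ 0 ∧
      (signedArea P - s * perimeter P + s ^ 2 * ∑ i, cotHalf P i = 0 →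
        ∀ i, dist (P i) (P (i + 1)) = s * (cotHalf P i + cotHalf P (i + 1))) := by
  obtain ⟨k, hk, hk'⟩ := h.exists_pi_lt hsum
  have h02 := h.cross_dir_pos hk
  have h24 := h.cross_dir_pos (i := k + 2) (by simpa only [add_assoc, Fin.reduceAdd] using hk')
  simp only [add_assoc, Fin.reduceAdd] at h24
  have h12 := h.cross_dir_succ_pos (k + 1)
  simp only [add_assoc, Fin.reduceAdd] at h12
  set X : (Fin 5 → ℝ) → ℝ := fun l ↦ l k * cross (dir P k) (dir P (k + 2)) +
    l (k + 1) * cross (dir P (k + 1)) (dir P (k + 2)) with hX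
  set q : Fin 5 → ℝ := fun i ↦ cotHalf P i + cotHalf P (i + 1) with hq
  have hqpos : ∀ i, 0 < q i := fun i ↦ add_pos (h.cotHalf_pos _) (h.cotHalf_pos _)
  have hXq : 0 < X q := add_pos (mul_pos (hqpos _) h02) (mul_pos (hqpos _) h12)
  set l : Fin 5 → ℝ := fun i ↦ dist (P i) (P (i + 1)) with hl
  have hdeg := area_nonpos_of_degenerate (r := fun i ↦ P i - (X l / X q : ℝ) * tangential P i)
    (u := dir P) (m := fun i ↦ l i - X l / X q * q i) (k := k) ?_ h.cross_dir_succ_pos h02 h24 ?_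
  · rw [h.signedArea_sub_tangential] at hdeg
    exact ⟨X l / X q, hdeg.1, fun h0 i ↦ by linarith [hdeg.2 h0 i]⟩
  · intro i
    have e1 := h.edge_eq i
    have e2 := h.tangential_edge i
    have hqi : ((q i : ℝ) : ℂ) = cotHalf P i + cotHalf P (i + 1) := by simp [hq]
    push_cast at e1 e2 ⊢
    rw [hqi]
    linear_combination e1 - (X l : ℂ) / X q * e2
  · have : X l - X l / X q * X q = 0 := by rw [div_mul_cancel₀ _ hXq.ne', sub_self]
    rw [← this]
    simp only [hX]; ring

/-- **Lhuilier's inequality** for pentagons. -/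
theorem lhuilier (hsum : ∑ i, interiorAngle P i = 3 * Real.pi) :
    4 * signedArea P * ∑ i, cotHalf P i ≤ perimeter P ^ 2 := by
  obtain ⟨s, hs, -⟩ := h.exists_quadratic_nonpos hsum
  have hS : 0 < ∑ i, cotHalf P i := Finset.sum_pos (fun i _ ↦ h.cotHalf_pos i) ⟨0, by simp⟩
  -- With S the cotangent sum, 4S times the quadratic is (L - 2sS)² - (L² - 4AS).
  nlinarith [sq_nonneg (perimeter P - 2 * s * ∑ i, cotHalf P i)]

/-- The pentagon is circumscribed if equality holds in Lhuilier's inequality. -/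
theorem eq_tangential_of_lhuilier_eq (hsum : ∑ i, interiorAngle P i = 3 * Real.pi)
    (heq : 4 * signedArea P * ∑ i, cotHalf P i = perimeter P ^ 2) :
    ∃ (c : ℂ) (s : ℝ), 0 < s ∧ ∀ i, P i = c + s * tangential P i := by
  obtain ⟨s, hs, hs'⟩ := h.exists_quadratic_nonpos hsum
  have hS : 0 < ∑ i, cotHalf P i := Finset.sum_pos (fun i _ ↦ h.cotHalf_pos i) ⟨0, by simp⟩
  have h0 : signedArea P - s * perimeter P + s ^ 2 * ∑ i, cotHalf P i = 0 := by
    refine le_antisymm hs ?_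
    have : 0 ≤ (4 * ∑ i, cotHalf P i) *
        (signedArea P - s * perimeter P + s ^ 2 * ∑ i, cotHalf P i) := by
      nlinarith [sq_nonneg (perimeter P - 2 * s * ∑ i, cotHalf P i)]
    exact nonneg_of_mul_nonneg_right this (by positivity)
  have hd := hs' h0
  refine ⟨P 0 - s * tangential P 0, s, ?_, ?_⟩
  · have h1 := h.dist_pos 0
    rw [hd 0] at h1
    exact pos_of_mul_pos_left h1 (add_pos (h.cotHalf_pos _) (h.cotHalf_pos _)).le
  · have step : ∀ i, P (i + 1) - s * tangential P (i + 1) = P i - s * tangential P i := by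
      intro i
      have e1 := h.edge_eq i
      have e2 := h.tangential_edge i
      rw [hd i] at e1
      push_cast at e1 e2
      linear_combination e1 - s * e2
    have s0 := step 0
    have s1 := step 1
    have s2 := step 2
    have s3 := step 3
    simp only [Fin.reduceAdd, zero_add] at s0 s1 s2 s3
    rw [Fin.forall_fin_succ, Fin.forall_fin_succ, Fin.forall_fin_succ, Fin.forall_fin_succ,
      Fin.forall_fin_one]
    simp only [Fin.succ_zero_eq_one, Fin.succ_one_eq_two, Fin.reduceSucc]
    refine ⟨by ring, ?_, ?_, ?_, ?_⟩
    · linear_combination s0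
    · linear_combination s0 + s1
    · linear_combination s0 + s1 + s2
    · linear_combination s0 + s1 + s2 + s3

end LocallyConvex

/-! ### Tangent-line bounds and values of the cotangent -/

/-- This is the tangent-line inequality for the cotangent at `d`, cleared of denominators. With δ =
|d - y|, it rests on δ < tan δ below `d`, and on sin δ < δ and monotonicity of the sine above. -/
lemma sub_mul_sin_lt {y d : ℝ} (hy0 : 0 < y) (hy : y < Real.pi / 2) (hd0 : 0 < d)
    (hd : d < Real.pi / 2) (hne : y ≠ d) :
    (d - y) * Real.sin y < Real.sin (d - y) * Real.sin d := by
  have hsd := Real.sin_pos_of_pos_of_lt_pi hd0 (by linarith)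
  rcases lt_or_gt_of_ne hne with hlt | hlt
  · have hcd := Real.cos_pos_of_mem_Ioo ⟨by linarith, hd⟩
    have hδ : 0 < d - y := by linarith
    have hcδ := Real.cos_pos_of_mem_Ioo (x := d - y) ⟨by linarith, by linarith⟩
    have hsδ := Real.sin_pos_of_pos_of_lt_pi hδ (by linarith)
    have htan := Real.lt_tan hδ (by linarith)
    rw [Real.tan_eq_sin_div_cos, lt_div_iff₀ hcδ] at htan
    have hsy : Real.sin y = Real.sin d * Real.cos (d - y) - Real.cos d * Real.sin (d - y) := by
      rw [← Real.sin_sub]; congr 1; ring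
    rw [hsy]
    nlinarith [mul_pos hcd (mul_pos hsδ hδ), mul_lt_mul_of_pos_right htan hsd]
  · have h1 : Real.sin d < Real.sin y :=
      Real.sin_lt_sin_of_lt_of_le_pi_div_two (by linarith) hy.le hlt
    have h2 : Real.sin (y - d) < y - d := Real.sin_lt (by linarith)
    have h3 : Real.sin (d - y) = -Real.sin (y - d) := by rw [← Real.sin_neg, neg_sub]
    have h4 : 0 < Real.sin (y - d) := Real.sin_pos_of_pos_of_lt_pi (by linarith) (by linarith)
    rw [h3]
    nlinarith [mul_lt_mul_of_pos_right h2 hsd, mul_lt_mul_of_pos_left h1 (sub_pos.2 hlt)]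

/-- The graph of `x ↦ cot (x / 2)` lies strictly above its tangent lines. -/
lemma cot_half_tangent_lt {x c : ℝ} (hx : x ∈ Set.Ioo 0 Real.pi) (hc : c ∈ Set.Ioo 0 Real.pi)
    (hne : x ≠ c) :
    Real.cot (c / 2) - (1 + Real.cot (c / 2) ^ 2) / 2 * (x - c) < Real.cot (x / 2) := by
  obtain ⟨hx0, hx1⟩ := hx
  obtain ⟨hc0, hc1⟩ := hc
  have h := sub_mul_sin_lt (y := x / 2) (d := c / 2) (by linarith) (by linarith) (by linarith)
    (by linarith) (fun e ↦ hne (by linarith))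
  have hsx := Real.sin_pos_of_pos_of_lt_pi (x := x / 2) (by linarith) (by linarith)
  have hsc := Real.sin_pos_of_pos_of_lt_pi (x := c / 2) (by linarith) (by linarith)
  have hsub : Real.cot (x / 2) - Real.cot (c / 2) =
      Real.sin (c / 2 - x / 2) / (Real.sin (x / 2) * Real.sin (c / 2)) := by
    rw [Real.cot_eq_cos_div_sin, Real.cot_eq_cos_div_sin, Real.sin_sub]
    field_simp
  have hcsc : 1 + Real.cot (c / 2) ^ 2 = 1 / Real.sin (c / 2) ^ 2 := by
    rw [Real.cot_eq_cos_div_sin]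
    field_simp
    linarith [Real.sin_sq_add_cos_sq (c / 2)]
  have hlt : (c / 2 - x / 2) / Real.sin (c / 2) ^ 2 <
      Real.sin (c / 2 - x / 2) / (Real.sin (x / 2) * Real.sin (c / 2)) := by
    rw [div_lt_div_iff₀ (by positivity) (by positivity)]
    nlinarith [mul_lt_mul_of_pos_right h hsc]
  have e : (1 + Real.cot (c / 2) ^ 2) / 2 * (x - c) =
      -((c / 2 - x / 2) / Real.sin (c / 2) ^ 2) := by
    rw [hcsc]; field_simp; ring
  rw [e]
  linarith

lemma cot_half_tangent_le {x c : ℝ} (hx : x ∈ Set.Ioo 0 Real.pi) (hc : c ∈ Set.Ioo 0 Real.pi) :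
    Real.cot (c / 2) - (1 + Real.cot (c / 2) ^ 2) / 2 * (x - c) ≤ Real.cot (x / 2) := by
  rcases eq_or_ne x c with rfl | hne
  · simp
  · exact (cot_half_tangent_lt hx hc hne).le

lemma cot_three_pi_div_ten_sq : Real.cot (3 * Real.pi / 10) ^ 2 = 5 - 2 * √5 := by
  have h5 : √5 ^ 2 = 5 := Real.sq_sqrt (by norm_num)
  have h5' : 0 < √5 := by positivity
  have e : 3 * Real.pi / 10 = Real.pi / 2 - Real.pi / 5 := by ring
  rw [Real.cot_eq_cos_div_sin, e, Real.cos_pi_div_two_sub, Real.sin_pi_div_two_sub, div_pow,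
    Real.sin_sq, Real.cos_pi_div_five, div_eq_iff (by positivity)]
  nlinarith

lemma cot_three_pi_div_ten_pos : 0 < Real.cot (3 * Real.pi / 10) :=
  cot_pos (by linarith [Real.pi_pos]) (by linarith [Real.pi_pos])

lemma sqrt_five_bounds : 2.236067 < √5 ∧ √5 < 2.236068 := by
  constructor
  · apply Real.lt_sqrt_of_sq_lt; norm_num
  · rw [Real.sqrt_lt' (by norm_num)]; norm_num

lemma cot_three_pi_div_ten_bounds :
    0.72654 < Real.cot (3 * Real.pi / 10) ∧ Real.cot (3 * Real.pi / 10) < 0.72655 := by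
  have h := cot_three_pi_div_ten_sq
  have hp := cot_three_pi_div_ten_pos
  have h5 := sqrt_five_bounds
  constructor
  · apply lt_of_pow_lt_pow_left₀ 2 hp.le; rw [h]; norm_num; linarith [h5.2]
  · apply lt_of_pow_lt_pow_left₀ 2 (by norm_num); rw [h]; norm_num; linarith [h5.1]

/-- Let v = cot(7π/20) and w = cot(3π/10). As 7π/10 = π - 3π/10, doubling gives v² + 2wv = 1, so (v
+ w)² = 1 + w² = (√5 - 1)². -/
lemma cot_seven_pi_div_twenty :
    Real.cot (7 * Real.pi / 20) = √5 - 1 - Real.cot (3 * Real.pi / 10) := by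
  have hπ := Real.pi_pos
  have hv := cot_pos (x := 7 * Real.pi / 20) (by linarith) (by linarith)
  have hw := cot_three_pi_div_ten_sq
  have hb := cot_three_pi_div_ten_bounds
  have h5 : √5 ^ 2 = 5 := Real.sq_sqrt (by norm_num)
  have h5b := sqrt_five_bounds
  have hs := Real.sin_pos_of_pos_of_lt_pi (x := 7 * Real.pi / 20) (by linarith) (by linarith)
  have hs' := Real.sin_pos_of_pos_of_lt_pi (x := 3 * Real.pi / 10) (by linarith) (by linarith)
  have hquad : Real.cot (7 * Real.pi / 20) ^ 2 +
      2 * Real.cot (3 * Real.pi / 10) * Real.cot (7 * Real.pi / 20) = 1 := by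
    have hc2 : Real.cos (2 * (7 * Real.pi / 20)) = -Real.cos (3 * Real.pi / 10) := by
      rw [← Real.cos_pi_sub]; congr 1; ring
    have hs2 : Real.sin (2 * (7 * Real.pi / 20)) = Real.sin (3 * Real.pi / 10) := by
      rw [← Real.sin_pi_sub]; congr 1; ring
    rw [Real.cos_two_mul, Real.cos_sq'] at hc2
    rw [Real.sin_two_mul] at hs2
    have hcc := Real.sin_sq_add_cos_sq (7 * Real.pi / 20)
    rw [Real.cot_eq_cos_div_sin, Real.cot_eq_cos_div_sin, ← hs2]
    have hcos : 0 < Real.cos (7 * Real.pi / 20) :=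
      Real.cos_pos_of_mem_Ioo ⟨by linarith, by linarith⟩
    rw [show Real.cos (3 * Real.pi / 10) = 2 * Real.sin (7 * Real.pi / 20) ^ 2 - 1 by linarith]
    field_simp
    linarith
  have hfac : (Real.cot (7 * Real.pi / 20) - (√5 - 1 - Real.cot (3 * Real.pi / 10))) *
      (Real.cot (7 * Real.pi / 20) + Real.cot (3 * Real.pi / 10) + √5 - 1) = 0 := by
    linear_combination hquad + hw - h5
  have := (mul_eq_zero.1 hfac).resolve_right (by linarith)
  linarith

/-! ### Minimizing the cotangent sum under the tiling conditions -/

/-- The sum of the cotangents of the half-angles of the minimizer. -/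
noncomputable def minCotSum : ℝ :=
  1 + 3 * Real.cot (3 * Real.pi / 10) + Real.cot (7 * Real.pi / 20)

lemma minCotSum_bounds : 3.68914 < minCotSum ∧ minCotSum < 3.68917 := by
  rw [minCotSum, cot_seven_pi_div_twenty]
  have h1 := sqrt_five_bounds
  have h2 := cot_three_pi_div_ten_bounds
  constructor <;> linarith [h1.1, h1.2, h2.1, h2.2]

lemma cot_half_ge_right {x : ℝ} (hx : x ∈ Set.Ioo 0 Real.pi) :
    1 - (x - Real.pi / 2) ≤ Real.cot (x / 2) := by
  have hπ := Real.pi_pos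
  have := cot_half_tangent_le hx (c := Real.pi / 2) ⟨by linarith, by linarith⟩
  rw [show Real.pi / 2 / 2 = Real.pi / 4 by ring, Real.cot_eq_cos_div_sin (Real.pi / 4),
    Real.cos_pi_div_four, Real.sin_pi_div_four, div_self (by positivity)] at this
  linarith

lemma cot_half_ge_hexagonal {x : ℝ} (hx : x ∈ Set.Ioo 0 Real.pi) :
    0.57735 - 2 / 3 * (x - 2 * Real.pi / 3) ≤ Real.cot (x / 2) := by
  have hπ := Real.pi_pos
  have := cot_half_tangent_le hx (c := 2 * Real.pi / 3) ⟨by linarith, by linarith⟩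
  have hc := cot_pos (x := Real.pi / 3) (by linarith) (by linarith)
  have hsq : Real.cot (Real.pi / 3) ^ 2 = 1 / 3 := by
    rw [Real.cot_eq_cos_div_sin, Real.cos_pi_div_three, Real.sin_pi_div_three, div_pow, div_pow,
      div_pow, Real.sq_sqrt (by norm_num)]
    norm_num
  have hlow : 0.57735 < Real.cot (Real.pi / 3) := by
    apply lt_of_pow_lt_pow_left₀ 2 hc.le; rw [hsq]; norm_num
  rw [show 2 * Real.pi / 3 / 2 = Real.pi / 3 by ring, hsq] at this
  linarith

/-- The exact slope is -(3 - √5) ≈ -0.76393; the constant is lowered from cot(3π/10) ≈ 0.72654 to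
pay for rounding it. -/
lemma cot_half_ge_pentagonal {x : ℝ} (hx : x ∈ Set.Ioo 0 Real.pi) :
    0.7262 - 0.764 * (x - 3 * Real.pi / 5) ≤ Real.cot (x / 2) := by
  have hπ := Real.pi_pos
  have hπ' := Real.pi_lt_d2
  have := cot_half_tangent_le hx (c := 3 * Real.pi / 5) ⟨by linarith, by linarith⟩
  rw [show 3 * Real.pi / 5 / 2 = 3 * Real.pi / 10 by ring, cot_three_pi_div_ten_sq] at this
  have h5 := sqrt_five_bounds
  have hb := cot_three_pi_div_ten_bounds
  obtain ⟨hx0, hx1⟩ := hx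
  nlinarith [mul_nonneg (sub_nonneg.2 h5.1.le) hx0.le, mul_nonneg (sub_nonneg.2 h5.2.le) hx0.le,
    mul_nonneg (sub_nonneg.2 h5.1.le) hπ.le, mul_nonneg (sub_nonneg.2 h5.2.le) hπ.le]

/-- Lowering `x₀` gains slope 1 and loses only slope 2/3 on the other angles, and at 7π/15 these
linear bounds already exceed 3.6892. -/
lemma lt_of_cot_sum_lt {x₀ x₁ x₂ x₃ x₄ : ℝ} (h₀ : x₀ ∈ Set.Ioo 0 Real.pi)
    (h₁ : x₁ ∈ Set.Ioo 0 Real.pi) (h₂ : x₂ ∈ Set.Ioo 0 Real.pi) (h₃ : x₃ ∈ Set.Ioo 0 Real.pi)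
    (h₄ : x₄ ∈ Set.Ioo 0 Real.pi) (hsum : x₀ + x₁ + x₂ + x₃ + x₄ = 3 * Real.pi)
    (hcot : Real.cot (x₀ / 2) + Real.cot (x₁ / 2) + Real.cot (x₂ / 2) + Real.cot (x₃ / 2) +
      Real.cot (x₄ / 2) < 3.6892) : 7 * Real.pi / 15 < x₀ := by
  linarith [Real.pi_gt_d4, cot_half_ge_right h₀, cot_half_ge_hexagonal h₁,
    cot_half_ge_hexagonal h₂, cot_half_ge_hexagonal h₃, cot_half_ge_hexagonal h₄]

set_option maxHeartbeats 4000000 in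
/-- Among admissible angles with small cotangent sum, four angles can sum to `2π` only if one of
them is a right angle. -/
lemma exists_eq_pi_div_two {x₀ x₁ x₂ x₃ x₄ : ℝ} (h₀ : x₀ ∈ Set.Ioo 0 Real.pi)
    (h₁ : x₁ ∈ Set.Ioo 0 Real.pi) (h₂ : x₂ ∈ Set.Ioo 0 Real.pi) (h₃ : x₃ ∈ Set.Ioo 0 Real.pi)
    (h₄ : x₄ ∈ Set.Ioo 0 Real.pi) (hsum : x₀ + x₁ + x₂ + x₃ + x₄ = 3 * Real.pi)
    (hcot : Real.cot (x₀ / 2) + Real.cot (x₁ / 2) + Real.cot (x₂ / 2) + Real.cot (x₃ / 2) +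
      Real.cot (x₄ / 2) < 3.6892) {m₀ m₁ m₂ m₃ m₄ : ℕ} (hm : m₀ + m₁ + m₂ + m₃ + m₄ = 4)
    (hmx : m₀ * x₀ + m₁ * x₁ + m₂ * x₂ + m₃ * x₃ + m₄ * x₄ = 2 * Real.pi) :
    x₀ = Real.pi / 2 ∨ x₁ = Real.pi / 2 ∨ x₂ = Real.pi / 2 ∨ x₃ = Real.pi / 2 ∨
      x₄ = Real.pi / 2 := by
  have hπ := Real.pi_gt_d4
  have hπ' := Real.pi_lt_d4
  have r₀ := cot_half_ge_right h₀
  have r₁ := cot_half_ge_right h₁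
  have r₂ := cot_half_ge_right h₂
  have r₃ := cot_half_ge_right h₃
  have r₄ := cot_half_ge_right h₄
  have s₀ := cot_half_ge_hexagonal h₀
  have s₁ := cot_half_ge_hexagonal h₁
  have s₂ := cot_half_ge_hexagonal h₂
  have s₃ := cot_half_ge_hexagonal h₃
  have s₄ := cot_half_ge_hexagonal h₄
  have p₀ := cot_half_ge_pentagonal h₀
  have p₁ := cot_half_ge_pentagonal h₁
  have p₂ := cot_half_ge_pentagonal h₂
  have p₃ := cot_half_ge_pentagonal h₃
  have p₄ := cot_half_ge_pentagonal h₄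
  have b₀ := lt_of_cot_sum_lt h₀ h₁ h₂ h₃ h₄ (by linarith only [hsum])
    (by linarith only [hcot])
  have b₁ := lt_of_cot_sum_lt h₁ h₀ h₂ h₃ h₄ (by linarith only [hsum])
    (by linarith only [hcot])
  have b₂ := lt_of_cot_sum_lt h₂ h₀ h₁ h₃ h₄ (by linarith only [hsum])
    (by linarith only [hcot])
  have b₃ := lt_of_cot_sum_lt h₃ h₀ h₁ h₂ h₄ (by linarith only [hsum])
    (by linarith only [hcot])
  have b₄ := lt_of_cot_sum_lt h₄ h₀ h₁ h₂ h₃ (by linarith only [hsum])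
    (by linarith only [hcot])
  replace h₀ := h₀.2
  replace h₁ := h₁.2
  replace h₂ := h₂.2
  replace h₃ := h₃.2
  replace h₄ := h₄.2
  have e₄ : m₄ = 4 - m₀ - m₁ - m₂ - m₃ := by omega
  have l₀ : m₀ ≤ 4 := by omega
  have l₁ : m₁ ≤ 4 - m₀ := by omega
  have l₂ : m₂ ≤ 4 - m₀ - m₁ := by omega
  have l₃ : m₃ ≤ 4 - m₀ - m₁ - m₂ := by omega
  clear hm
  subst e₄
  -- Four copies of one angle make it right; every other choice contradicts the tangent-line bounds.
  interval_cases m₀ <;> norm_num only at l₁ <;> interval_cases m₁ <;> norm_num only at l₂ <;>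
    interval_cases m₂ <;> norm_num only at l₃ <;> interval_cases m₃ <;>
    norm_num only [Nat.cast_zero, Nat.cast_one, Nat.cast_ofNat] at hmx <;>
  first
  | (left; linarith only [hmx])
  | (right; left; linarith only [hmx])
  | (right; right; left; linarith only [hmx])
  | (right; right; right; left; linarith only [hmx])
  | (right; right; right; right; linarith only [hmx])
  | (exfalso; linarith)

/-- The largest angle is at least `7π/10` if the second smallest angle tiles. -/
lemma seven_pi_div_ten_le {x₁ x₂ x₃ x₄ : ℝ} (h₁ : Real.pi / 2 < x₁) (h₁₂ : x₁ ≤ x₂)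
    (h₂₃ : x₂ ≤ x₃) (h₃₄ : x₃ ≤ x₄) (h₄ : x₄ < Real.pi)
    (hsum : x₁ + x₂ + x₃ + x₄ = 5 * Real.pi / 2) {m₀ m₁ m₂ m₃ m₄ : ℕ} (hm : 0 < m₁)
    (hmx : m₀ * (Real.pi / 2) + m₁ * x₁ + m₂ * x₂ + m₃ * x₃ + m₄ * x₄ = 2 * Real.pi) :
    7 * Real.pi / 10 ≤ x₄ := by
  have hπ := Real.pi_pos
  have c₀ : (0 : ℝ) ≤ m₀ := by positivity
  have c₁ : (1 : ℝ) ≤ m₁ := by exact_mod_cast hm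
  have c₂ : (0 : ℝ) ≤ m₂ := by positivity
  have c₃ : (0 : ℝ) ≤ m₃ := by positivity
  have c₄ : (0 : ℝ) ≤ m₄ := by positivity
  -- Exactly three angles are used: all are at least π/2, with `x₁` above it, and all are less than
  -- π.
  have hlt : m₀ + m₁ + m₂ + m₃ + m₄ < 4 := by
    have : (m₀ + m₁ + m₂ + m₃ + m₄ : ℝ) < 4 := by
      by_contra! hge
      nlinarith [mul_le_mul_of_nonneg_right hge hπ.le,
        mul_nonneg c₂ (by linarith : 0 ≤ x₂ - Real.pi / 2),
        mul_nonneg c₃ (by linarith : 0 ≤ x₃ - Real.pi / 2),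
        mul_nonneg c₄ (by linarith : 0 ≤ x₄ - Real.pi / 2),
        mul_le_mul_of_nonneg_right c₁ (by linarith : 0 ≤ x₁ - Real.pi / 2)]
    exact_mod_cast this
  have hgt : 2 < m₀ + m₁ + m₂ + m₃ + m₄ := by
    have : (2 : ℝ) < m₀ + m₁ + m₂ + m₃ + m₄ := by
      by_contra! hle
      nlinarith [mul_le_mul_of_nonneg_right hle hπ.le, mul_nonneg c₀ hπ.le,
        mul_nonneg c₂ (by linarith : 0 ≤ Real.pi - x₂),
        mul_nonneg c₃ (by linarith : 0 ≤ Real.pi - x₃),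
        mul_nonneg c₄ (sub_nonneg.2 h₄.le),
        mul_le_mul_of_nonneg_right c₁ (by linarith : 0 ≤ Real.pi - x₁)]
    exact_mod_cast this
  -- A triple containing `x₁` has sum at most x₁ + 2x₄, so x₁ ≥ 2π - 2x₄; then 3x₁ + x₄ ≤ 5π/2
  -- yields the bound.
  by_contra! hD
  clear c₀ c₁ c₂ c₃ c₄
  have e₁ : m₁ = 3 - m₀ - m₂ - m₃ - m₄ := by omega
  have l₀ : m₀ ≤ 2 := by omega
  have l₂ : m₂ ≤ 2 - m₀ := by omega
  have l₃ : m₃ ≤ 2 - m₀ - m₂ := by omega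
  have l₄ : m₄ ≤ 2 - m₀ - m₂ - m₃ := by omega
  clear hm hlt hgt
  subst e₁
  interval_cases m₀ <;> norm_num only at l₂ <;> interval_cases m₂ <;> norm_num only at l₃ <;>
    interval_cases m₃ <;> norm_num only at l₄ <;> interval_cases m₄ <;>
    norm_num only [Nat.cast_zero, Nat.cast_one, Nat.cast_ofNat] at hmx <;> linarith

/-- Tangent lines are taken at the extremal angles. The slope at 7π/10 is flatter than at 3π/5, so
enlarging `x 4` only raises the bound; strictness off the tangency points gives uniqueness. -/
lemma minCotSum_le_of_ge {x : Fin 5 → ℝ} (hx : ∀ i, x i ∈ Set.Ioo 0 Real.pi)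
    (hx0 : x 0 = Real.pi / 2) (hx4 : 7 * Real.pi / 10 ≤ x 4)
    (hsum : x 0 + x 1 + x 2 + x 3 + x 4 = 3 * Real.pi) :
    minCotSum ≤ Real.cot (x 0 / 2) + Real.cot (x 1 / 2) + Real.cot (x 2 / 2) +
      Real.cot (x 3 / 2) + Real.cot (x 4 / 2) ∧ (Real.cot (x 0 / 2) + Real.cot (x 1 / 2) +
      Real.cot (x 2 / 2) + Real.cot (x 3 / 2) + Real.cot (x 4 / 2) = minCotSum →
      x = ![Real.pi / 2, 3 * Real.pi / 5, 3 * Real.pi / 5, 3 * Real.pi / 5, 7 * Real.pi / 10]) := by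
  have hπ := Real.pi_pos
  have c3 : 3 * Real.pi / 5 ∈ Set.Ioo 0 Real.pi := ⟨by linarith, by linarith⟩
  have c7 : 7 * Real.pi / 10 ∈ Set.Ioo 0 Real.pi := ⟨by linarith, by linarith⟩
  have e3 : 3 * Real.pi / 5 / 2 = 3 * Real.pi / 10 := by ring
  have e7 : 7 * Real.pi / 10 / 2 = 7 * Real.pi / 20 := by ring
  have t₁ := cot_half_tangent_le (hx 1) c3
  have t₂ := cot_half_tangent_le (hx 2) c3
  have t₃ := cot_half_tangent_le (hx 3) c3
  have t₄ := cot_half_tangent_le (hx 4) c7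
  rw [e3] at t₁ t₂ t₃
  rw [e7] at t₄
  have t₀ : Real.cot (x 0 / 2) = 1 := by
    rw [hx0, show Real.pi / 2 / 2 = Real.pi / 4 by ring, Real.cot_eq_cos_div_sin,
      Real.cos_pi_div_four, Real.sin_pi_div_four, div_self (by positivity)]
  have hv := cot_seven_pi_div_twenty
  have hb := cot_three_pi_div_ten_bounds
  have h5 := sqrt_five_bounds
  rw [t₀]
  unfold minCotSum
  set w := Real.cot (3 * Real.pi / 10)
  set v := Real.cot (7 * Real.pi / 20)
  have hvw : 0 < (1 + w ^ 2) / 2 - (1 + v ^ 2) / 2 := by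
    have h1 : v < w := by linarith [hb.1, h5.2]
    have h2 : 0 < v := by linarith [hb.2, h5.1]
    linarith [pow_lt_pow_left₀ h1 h2.le two_ne_zero]
  have hprod := mul_nonneg hvw.le (sub_nonneg.2 hx4)
  have hlin : 1 + (w - (1 + w ^ 2) / 2 * (x 1 - 3 * Real.pi / 5)) +
      (w - (1 + w ^ 2) / 2 * (x 2 - 3 * Real.pi / 5)) +
      (w - (1 + w ^ 2) / 2 * (x 3 - 3 * Real.pi / 5)) +
      (v - (1 + v ^ 2) / 2 * (x 4 - 7 * Real.pi / 10)) =
      1 + 3 * w + v + ((1 + w ^ 2) / 2 - (1 + v ^ 2) / 2) * (x 4 - 7 * Real.pi / 10) := by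
    linear_combination -(1 + w ^ 2) / 2 * (hsum - hx0)
  refine ⟨by linarith, fun heq ↦ ?_⟩
  have y₁ : x 1 = 3 * Real.pi / 5 := by
    by_contra hne
    have := cot_half_tangent_lt (hx 1) c3 hne
    rw [e3] at this
    linarith
  have y₂ : x 2 = 3 * Real.pi / 5 := by
    by_contra hne
    have := cot_half_tangent_lt (hx 2) c3 hne
    rw [e3] at this
    linarith
  have y₃ : x 3 = 3 * Real.pi / 5 := by
    by_contra hne
    have := cot_half_tangent_lt (hx 3) c3 hne
    rw [e3] at this
    linarith
  have y₄ : x 4 = 7 * Real.pi / 10 := by linarith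
  ext i
  fin_cases i
  · exact hx0
  · exact y₁
  · exact y₂
  · exact y₃
  · exact y₄

/-- Near the minimum, the degree-four vertex makes the smallest angle right, and tiling by the
second smallest pushes the largest up to 7π/10. -/
lemma minCotSum_le_of_sorted {x : Fin 5 → ℝ} (hx : ∀ i, x i ∈ Set.Ioo 0 Real.pi)
    (hmono : Monotone x) (hsum : ∑ i, x i = 3 * Real.pi) (htile : AngleTiles x 1)
    (hfour : ∃ j, AngleTilesDegreeFour x j) :
    minCotSum ≤ ∑ i, Real.cot (x i / 2) ∧ (∑ i, Real.cot (x i / 2) = minCotSum →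
      x = ![Real.pi / 2, 3 * Real.pi / 5, 3 * Real.pi / 5, 3 * Real.pi / 5, 7 * Real.pi / 10]) := by
  have hπ := Real.pi_gt_d4
  have hπ' := Real.pi_lt_d4
  have hT := minCotSum_bounds
  obtain ⟨j, m, -, hm, hmx⟩ := hfour
  obtain ⟨n, hn, hnx⟩ := htile
  rw [Fin.sum_univ_five] at hm hmx hnx hsum
  simp only [Fin.sum_univ_five]
  rcases le_or_gt 3.6892 (Real.cot (x 0 / 2) + Real.cot (x 1 / 2) + Real.cot (x 2 / 2) +
    Real.cot (x 3 / 2) + Real.cot (x 4 / 2)) with hbig | hsmall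
  · exact ⟨by linarith, fun h ↦ by linarith⟩
  have h01 : x 0 ≤ x 1 := hmono (by decide)
  have h12 : x 1 ≤ x 2 := hmono (by decide)
  have h23 : x 2 ≤ x 3 := hmono (by decide)
  have h34 : x 3 ≤ x 4 := hmono (by decide)
  -- Two angles of at most π/2 would force a cotangent sum of at least about 2 + √3.
  have hx1 : Real.pi / 2 < x 1 := by
    have r₀ := cot_half_ge_right (hx 0)
    have r₁ := cot_half_ge_right (hx 1)
    have s₂ := cot_half_ge_hexagonal (hx 2)
    have s₃ := cot_half_ge_hexagonal (hx 3)
    have s₄ := cot_half_ge_hexagonal (hx 4)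
    linarith
  have hx0 : x 0 = Real.pi / 2 := by
    rcases exists_eq_pi_div_two (hx 0) (hx 1) (hx 2) (hx 3) (hx 4) hsum hsmall hm hmx with
      e | e | e | e | e
    · exact e
    all_goals linarith
  rw [hx0] at hnx
  have hx4 := seven_pi_div_ten_le hx1 h12 h23 h34 (hx 4).2 (by linarith) hn hnx
  exact minCotSum_le_of_ge hx hx0 hx4 hsum

/-- The angles of the minimizer are the unique minimum of the sum of the cotangents of the
half-angles, among all angles of convex pentagons that tile, one of them a vertex of degree
four. -/
theorem minCotSum_le {a : Fin 5 → ℝ} (ha : ∀ i, a i ∈ Set.Ioo 0 Real.pi)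
    (hsum : ∑ i, a i = 3 * Real.pi) (htile : ∀ j, AngleTiles a j)
    (hfour : ∃ j, AngleTilesDegreeFour a j) :
    minCotSum ≤ ∑ i, Real.cot (a i / 2) ∧ (∑ i, Real.cot (a i / 2) = minCotSum →
      Multiset.map a Finset.univ.val =
        {Real.pi / 2, 3 * Real.pi / 5, 3 * Real.pi / 5, 3 * Real.pi / 5, 7 * Real.pi / 10}) := by
  set σ := Tuple.sort a
  have htile' : AngleTiles (a ∘ σ) 1 := by
    obtain ⟨m, h0, h⟩ := htile (σ 1)
    refine ⟨m ∘ σ, h0, ?_⟩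
    rw [← h]
    exact Equiv.sum_comp σ (fun i ↦ (m i : ℝ) * a i)
  have hfour' : ∃ j, AngleTilesDegreeFour (a ∘ σ) j := by
    obtain ⟨j, m, h0, h4, h⟩ := hfour
    refine ⟨σ.symm j, m ∘ σ, by simpa using h0, ?_, ?_⟩
    · rw [← h4]
      exact Equiv.sum_comp σ m
    · rw [← h]
      exact Equiv.sum_comp σ (fun i ↦ (m i : ℝ) * a i)
  have h := minCotSum_le_of_sorted (x := a ∘ σ) (fun i ↦ ha _) (Tuple.monotone_sort a)
    ((Equiv.sum_comp σ a).trans hsum) htile' hfour'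
  have hc : ∑ i, Real.cot ((a ∘ σ) i / 2) = ∑ i, Real.cot (a i / 2) :=
    Equiv.sum_comp σ (fun i ↦ Real.cot (a i / 2))
  rw [hc] at h
  refine ⟨h.1, fun heq ↦ ?_⟩
  have hmap : Multiset.map (a ∘ σ) Finset.univ.val = Multiset.map a Finset.univ.val := by
    rw [← Multiset.map_map, Multiset.map_univ_val_equiv]
  rw [← hmap, h.2 heq]
  rfl

/-! ### Circumscribed pentagons: characterization and existence -/

/-- A convex pentagon all of whose pairs of consecutive angles have sum greater than `π` is
simple. -/
lemma LocallyConvex.isSimple {P : Polygon ℂ 5} (h : LocallyConvex P)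
    (hpair : ∀ i, Real.pi < interiorAngle P (i + 1) + interiorAngle P (i + 2)) : IsSimple P := by
  -- The edge `i + 2` points to the left of the edge `i`, so `P (i + 3)` is farther from its line
  -- than `P (i + 2)`. With `hs'`, each edge line has all other vertices strictly on its left.
  have hs : ∀ i, 0 < orient (P i) (P (i + 1)) (P (i + 3)) := by
    intro i
    have e2 := h.edge_eq (i + 2)
    have d2 := h.dist_pos (i + 2)
    simp only [add_assoc, Fin.reduceAdd] at e2 d2
    have e : orient (P i) (P (i + 1)) (P (i + 3)) = orient (P i) (P (i + 1)) (P (i + 2)) +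
        cross (P (i + 1) - P i) (P (i + 3) - P (i + 2)) := by
      simp only [orient, cross, Complex.sub_re, Complex.sub_im]; ring
    have e' : cross (P (i + 1) - P i) (P (i + 3) - P (i + 2)) = dist (P i) (P (i + 1)) *
        dist (P (i + 2)) (P (i + 3)) * cross (dir P i) (dir P (i + 2)) := by
      rw [h.edge_eq i, e2]
      simp only [cross, Complex.re_ofReal_mul, Complex.im_ofReal_mul]; ring
    rw [e, e']
    exact add_pos (h i) (mul_pos (mul_pos (h.dist_pos i) d2) (h.cross_dir_pos (hpair i)))
  have hs' : ∀ i, 0 < orient (P i) (P (i + 1)) (P (i + 4)) := by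
    intro i
    have := h (i + 4)
    simp only [add_assoc, Fin.reduceAdd, add_zero] at this
    refine this.trans_eq ?_
    simp only [orient, cross, Complex.sub_re, Complex.sub_im]; ring
  have hlin : ∀ (a b p q : ℂ) (r : ℝ), orient a b (p + r * (q - p)) =
      (1 - r) * orient a b p + r * orient a b q := by
    intro a b p q r
    simp only [orient, cross, Complex.sub_re, Complex.sub_im, Complex.add_re, Complex.add_im,
      Complex.re_ofReal_mul, Complex.im_ofReal_mul]
    ring
  have hon : ∀ (a b : ℂ) (r : ℝ), orient a b (a + r * (b - a)) = 0 := by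
    intro a b r
    rw [hlin]
    simp only [orient, cross, Complex.sub_re, Complex.sub_im]; ring
  constructor
  · intro i
    apply Set.eq_singleton_iff_unique_mem.2
    refine ⟨⟨mem_edgeSet.2 ⟨1, zero_le_one, le_rfl, by push_cast; ring⟩,
      mem_edgeSet.2 ⟨0, le_rfl, zero_le_one, by push_cast; ring⟩⟩, ?_⟩
    rintro x ⟨hx, hx'⟩
    obtain ⟨r, -, -, rfl⟩ := mem_edgeSet.1 hx
    obtain ⟨t, -, -, ht⟩ := mem_edgeSet.1 hx'
    have h0 := hon (P i) (P (i + 1)) r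
    rw [ht, hlin] at h0
    simp only [add_assoc, Fin.reduceAdd] at h0
    have h1 : orient (P i) (P (i + 1)) (P (i + 1)) = 0 := by simp only [orient, cross]; ring
    rw [h1, mul_zero, zero_add] at h0
    have ht0 := (mul_eq_zero.1 h0).resolve_right (h i).ne'
    rw [ht, ht0]; push_cast; ring
  · intro i j h1 h2 h3
    refine Set.disjoint_left.2 fun x hx hx' ↦ ?_
    obtain ⟨r, -, -, rfl⟩ := mem_edgeSet.1 hx
    obtain ⟨t, t0, t1, ht⟩ := mem_edgeSet.1 hx'
    have h0 := hon (P i) (P (i + 1)) r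
    rw [ht, hlin] at h0
    have hj : ∀ i j : Fin 5, j ≠ i → j ≠ i + 1 → i ≠ j + 1 →
        j = i + 2 ∧ j + 1 = i + 3 ∨ j = i + 3 ∧ j + 1 = i + 4 := by decide
    have hpos : ∀ p q : ℝ, 0 < p → 0 < q → (1 - t) * p + t * q ≠ 0 := by
      intro p q hp hq
      rcases t0.eq_or_lt with rfl | t0
      · simpa using hp.ne'
      · exact (add_pos_of_nonneg_of_pos (mul_nonneg (by linarith) hp.le) (mul_pos t0 hq)).ne'
    rcases hj i j h1 h2 h3 with ⟨ha, hb⟩ | ⟨ha, hb⟩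
    · rw [hb, ha] at h0
      exact hpos _ _ (h i) (hs i) h0
    · rw [hb, ha] at h0
      exact hpos _ _ (hs i) (hs' i) h0

section Circumscribed

variable {P : Polygon ℂ 5}

lemma LocallyConvex.dist_eq_of_eq_tangential (h : LocallyConvex P) {c : ℂ} {s : ℝ} (hs : 0 < s)
    (hP : ∀ i, P i = c + s * tangential P i) (i : Fin 5) :
    dist (P i) (P (i + 1)) = s * (cotHalf P i + cotHalf P (i + 1)) := by
  have hq : 0 < s * (cotHalf P i + cotHalf P (i + 1)) :=
    mul_pos hs (add_pos (h.cotHalf_pos _) (h.cotHalf_pos _))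
  have : P (i + 1) - P i = ((s * (cotHalf P i + cotHalf P (i + 1)) : ℝ) : ℂ) * dir P i := by
    have e := h.tangential_edge i
    push_cast at e ⊢
    linear_combination hP (i + 1) - hP i + s * e
  rw [dist_comm, dist_eq_norm, this, norm_mul, h.norm_dir, Complex.norm_real, mul_one,
    Real.norm_eq_abs, abs_of_pos hq]

lemma LocallyConvex.perimeter_area_of_eq_tangential (h : LocallyConvex P) {c : ℂ} {s : ℝ}
    (hs : 0 < s) (hP : ∀ i, P i = c + s * tangential P i) :
    perimeter P = 2 * s * ∑ i, cotHalf P i ∧ signedArea P = s ^ 2 * ∑ i, cotHalf P i := by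
  have hper : perimeter P = 2 * s * ∑ i, cotHalf P i := by
    have hshift : ∑ i, cotHalf P (i + 1) = ∑ i, cotHalf P i :=
      Equiv.sum_comp (Equiv.addRight (1 : Fin 5)) (cotHalf P)
    simp only [perimeter, h.dist_eq_of_eq_tangential hs hP, ← Finset.mul_sum,
      Finset.sum_add_distrib, hshift]
    ring
  refine ⟨hper, ?_⟩
  have hconst : (fun i ↦ P i - s * tangential P i) = fun _ ↦ c := by
    funext i
    linear_combination hP i
  have h0 := h.signedArea_sub_tangential s
  have h1 : signedArea ⟨fun _ ↦ c⟩ = 0 := by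
    simp only [signedArea, im_conj_mul]
    simp [cross, mul_comm]
  rw [hconst, h1, hper] at h0
  linarith

lemma LocallyConvex.isCircumscribed_of_eq_tangential (h : LocallyConvex P) {c : ℂ} {s : ℝ}
    (hs : 0 < s) (hP : ∀ i, P i = c + s * tangential P i) : IsCircumscribed P := by
  refine ⟨⟨c, s⟩, hs, fun i ↦ ?_⟩
  have hq : 0 < cotHalf P i + cotHalf P (i + 1) := add_pos (h.cotHalf_pos _) (h.cotHalf_pos _)
  have hqc : (cotHalf P i + cotHalf P (i + 1) : ℂ) ≠ 0 := by exact_mod_cast hq.ne'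
  have htan : tangential P i + cotHalf P i * dir P i = -Complex.I * dir P i := by
    rw [tangential]; ring
  have he := h.tangential_edge i
  push_cast at he
  have hmem : c + s * (-Complex.I * dir P i) ∈ P.edgeSet ℝ i := by
    refine mem_edgeSet.2 ⟨cotHalf P i / (cotHalf P i + cotHalf P (i + 1)),
      div_nonneg (h.cotHalf_pos i).le hq.le, ?_, ?_⟩
    · rw [div_le_one hq]; linarith [h.cotHalf_pos (i + 1)]
    · rw [hP i, hP (i + 1), ← htan]
      push_cast
      field_simp
      linear_combination -(s : ℂ) * cotHalf P i * he
  have horth : ∀ x : ℝ, inner ℝ ((x : ℂ) * dir P i) (s * (-Complex.I * dir P i)) = 0 := by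
    intro x
    simp [Complex.inner]
    ring
  refine ⟨_, hmem, ?_, ?_, ?_⟩
  · rw [EuclideanGeometry.mem_sphere, dist_eq_norm]
    simp [h.norm_dir, abs_of_pos hs]
  · obtain ⟨r, -, -, hr⟩ := mem_edgeSet.1 hmem
    have : c + s * (-Complex.I * dir P i) = AffineMap.lineMap (P i) (P (i + 1)) r := by
      rw [hr]; simp [AffineMap.lineMap_apply]; ring
    rw [this]
    exact AffineMap.lineMap_mem_affineSpan_pair _ _ _
  · rw [affineSpan_le]
    rintro x (rfl | rfl)
    · rw [SetLike.mem_coe, EuclideanGeometry.Sphere.mem_orthRadius_iff_inner_left]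
      convert horth (-(s * cotHalf P i)) using 2
      · rw [hP i, ← htan]; simp; ring
      · simp
    · rw [SetLike.mem_coe, EuclideanGeometry.Sphere.mem_orthRadius_iff_inner_left]
      convert horth (s * cotHalf P (i + 1)) using 2
      · rw [hP (i + 1), ← htan]; simp; linear_combination s * he
      · simp

/-- The tangency data of an edge of unit direction `u`. -/
lemma exists_signed_radius {a b c t u : ℂ} {d ρ r : ℝ} (hd : 0 < d) (hu : ‖u‖ = 1)
    (hab : b - a = d * u) (hρ0 : 0 ≤ ρ) (hρ1 : ρ ≤ 1) (ht : t = a + ρ * (b - a))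
    (hr : dist t c = r) (ha : inner ℝ (a - t) (t - c) = 0) (hb : inner ℝ (b - t) (t - c) = 0) :
    ∃ η α β : ℝ, η ^ 2 = r ^ 2 ∧ 0 ≤ α ∧ 0 ≤ β ∧ a = c - (α + η * Complex.I) * u ∧
      b = c + (β - η * Complex.I) * u := by
  have hperp : inner ℝ (d * u) (t - c) = 0 := by
    rw [← hab, show b - a = (b - t) - (a - t) by ring, inner_sub_left, ha, hb, sub_zero]
  have hre : (conj u * (t - c)).re = 0 := by
    have e : (t - c) * conj ((d : ℂ) * u) = d * (conj u * (t - c)) := by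
      rw [map_mul, Complex.conj_ofReal]; ring
    rw [Complex.inner, e, Complex.re_ofReal_mul] at hperp
    exact (mul_eq_zero.1 hperp).resolve_left hd.ne'
  have huu : u * conj u = 1 := by rw [Complex.mul_conj', hu]; simp
  have htc : t - c = ((conj u * (t - c)).im : ℂ) * Complex.I * u := by
    have : conj u * (t - c) = ((conj u * (t - c)).im : ℂ) * Complex.I := by
      conv_lhs => rw [← Complex.re_add_im (conj u * (t - c)), hre]
      simp [-Complex.mul_im]
    rw [← this]
    linear_combination -(t - c) * huu
  refine ⟨-(conj u * (t - c)).im, ρ * d, (1 - ρ) * d, ?_, mul_nonneg hρ0 hd.le,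
    mul_nonneg (by linarith) hd.le, ?_, ?_⟩
  · rw [← hr, dist_eq_norm]
    conv_rhs => rw [htc]
    simp [-Complex.mul_re, -Complex.mul_im, hu]
  · push_cast
    linear_combination htc - ht - ρ * hab
  · push_cast
    linear_combination htc - ht - ρ * hab + hab

/-- The two tangent lengths at a vertex agree. The half-angle relation then equates the signed
distances η of the centre from the two edges and gives length t·η; nonnegativity of lengths makes η
the radius. -/
lemma LocallyConvex.exists_eq_tangential (h : LocallyConvex P) (hc : IsCircumscribed P) :
    ∃ (c : ℂ) (s : ℝ), 0 < s ∧ ∀ i, P i = c + s * tangential P i := by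
  obtain ⟨⟨c, r⟩, hr, ht⟩ := hc
  simp only at hr
  have hdata : ∀ i, ∃ η α β : ℝ, η ^ 2 = r ^ 2 ∧ 0 ≤ α ∧ 0 ≤ β ∧
      P i = c - (α + η * Complex.I) * dir P i ∧ P (i + 1) = c + (β - η * Complex.I) * dir P i := by
    intro i
    obtain ⟨t, hmem, htan⟩ := ht i
    obtain ⟨ρ, hρ0, hρ1, hρ⟩ := mem_edgeSet.1 hmem
    exact exists_signed_radius (h.dist_pos i) (h.norm_dir i) (h.edge_eq i) hρ0 hρ1 hρ
      (EuclideanGeometry.mem_sphere.1 htan.mem_sphere)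
      (htan.inner_left_eq_zero_of_mem (left_mem_affineSpan_pair ℝ _ _))
      (htan.inner_left_eq_zero_of_mem (right_mem_affineSpan_pair ℝ _ _))
  refine ⟨c, r, hr, ?_⟩
  have hsucc : ∀ i, P (i + 1) = c + r * tangential P (i + 1) := by
    intro i
    obtain ⟨η, -, β, hη, -, hβ, -, e⟩ := hdata i
    obtain ⟨η', α, -, hη', hα, -, e', -⟩ := hdata (i + 1)
    have hn := congrArg (fun z ↦ ‖z - c‖ ^ 2) (e.symm.trans e')
    have n1 : ∀ x y : ℝ, ‖(x : ℂ) + y * Complex.I‖ ^ 2 = x ^ 2 + y ^ 2 := by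
      intro x y
      rw [← Complex.normSq_eq_norm_sq, Complex.normSq_add_mul_I]
    have hβα : β = α := by
      have h1 : ‖c + (β - η * Complex.I) * dir P i - c‖ ^ 2 = β ^ 2 + (-η) ^ 2 := by
        rw [add_sub_cancel_left, norm_mul, h.norm_dir, mul_one, ← n1]
        push_cast; ring_nf
      have h2 : ‖c - (α + η' * Complex.I) * dir P (i + 1) - c‖ ^ 2 = α ^ 2 + η' ^ 2 := by
        rw [sub_sub_cancel_left, norm_neg, norm_mul, h.norm_dir, mul_one, ← n1]
      simp only [h1, h2] at hn
      exact (pow_left_inj₀ hβ hα two_ne_zero).1 (by linarith)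
    have hrel := cot_half_mul_eq (locallyConvex_iff.1 h (i + 1)) (h.dir_succ i)
    rw [← cotHalf] at hrel
    set t := cotHalf P (i + 1) with htdef
    have htpos : 0 < t := h.cotHalf_pos _
    have hz : (1 - Complex.I * t) * (α - η * Complex.I) +
        (1 + Complex.I * t) * (α + η' * Complex.I) = 0 := by
      have hne := h.dir_ne_zero (i + 1)
      rw [← mul_left_inj' hne, zero_mul]
      rw [hβα] at e
      linear_combination (α - η * Complex.I) * hrel + (1 + Complex.I * t) * (e' - e)
    have hzr := congrArg Complex.re hz
    have hzi := congrArg Complex.im hz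
    simp at hzr hzi
    have hηη : η' = η := by linarith
    rw [hηη] at hzr
    have hαη : α = t * η := by linarith
    have hηpos : 0 ≤ η := by
      by_contra! hneg
      nlinarith [mul_pos htpos (neg_pos.2 hneg)]
    have hηr : η = r := (pow_left_inj₀ hηpos hr.le two_ne_zero).1 hη
    rw [e', tangential, ← htdef, hηη, hαη, hηr]
    push_cast
    ring
  intro i
  have := hsucc (i - 1)
  rwa [sub_add_cancel] at this

end Circumscribed

lemma interiorAngle_eq_of_edges {P : Polygon ℂ 5} {i : Fin 5} {l l' a : ℝ} {u v : ℂ}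
    (hl : 0 < l) (hl' : 0 < l') (ha : a ∈ Set.Ioo 0 Real.pi) (hu : u ≠ 0)
    (huv : v = -u * Complex.exp (-(a * Complex.I))) (h : P (i + 1) - P i = l * u)
    (h' : P (i + 2) - P (i + 1) = l' * v) : interiorAngle P (i + 1) = a := by
  have hz : -(P (i + 1) - P i) / (P (i + 2) - P (i + 1)) =
      ((l / l' : ℝ) : ℂ) * (Complex.cos a + Complex.sin a * Complex.I) := by
    have c1 : (l' : ℂ) ≠ 0 := by exact_mod_cast hl'.ne'
    have c2 := Complex.exp_ne_zero (a * Complex.I)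
    rw [h, h', huv, ← Complex.exp_mul_I, Complex.exp_neg]
    push_cast
    field_simp
  rw [interiorAngle_succ, hz, Complex.arg_mul_cos_add_sin_mul_I (div_pos hl hl')
    ⟨by linarith [ha.1, Real.pi_pos], ha.2.le⟩, toIcoMod_eq_self]
  exact ⟨ha.1.le, by linarith [ha.2, Real.pi_pos]⟩

/-- There is a unit-area pentagon circumscribed about a circle with prescribed angles. -/
lemma exists_circumscribed {a : Fin 5 → ℝ} (ha : ∀ i, a i ∈ Set.Ioo 0 Real.pi)
    (hsum : ∑ i, a i = 3 * Real.pi) (hpair : ∀ i, Real.pi < a (i + 1) + a (i + 2)) :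
    ∃ P : Polygon ℂ 5, IsUnitPentagon P ∧ IsCircumscribed P ∧ interiorAngle P = a := by
  set E : Fin 5 → ℂ := fun i ↦ -Complex.exp (-(a i * Complex.I)) with hE
  have hEn : ∀ i, ‖E i‖ = 1 := by
    intro i
    rw [hE]
    simp only [norm_neg]
    rw [← neg_mul, ← Complex.ofReal_neg, Complex.norm_exp_ofReal_mul_I]
  -- The angle sum 3π makes the five turns close up.
  have hprod : E 1 * E 2 * E 3 * E 4 * E 0 = 1 := by
    have : Complex.exp (-(((∑ i, a i : ℝ) : ℂ) * Complex.I)) = -1 := by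
      rw [hsum, ← neg_mul, ← Complex.ofReal_neg, Complex.exp_mul_I, ← Complex.ofReal_cos,
        ← Complex.ofReal_sin, Real.cos_neg, Real.sin_neg,
        show 3 * Real.pi = Real.pi + 2 * Real.pi by ring, Real.cos_add_two_pi,
        Real.sin_add_two_pi]
      simp
    rw [Fin.sum_univ_five] at this
    push_cast at this
    rw [add_mul, add_mul, add_mul, add_mul] at this
    simp only [neg_add, Complex.exp_add] at this
    simp only [hE]
    linear_combination -this
  set u : Fin 5 → ℂ := ![1, E 1, E 1 * E 2, E 1 * E 2 * E 3, E 1 * E 2 * E 3 * E 4] with hu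
  have hun : ∀ i, ‖u i‖ = 1 := by
    intro i
    fin_cases i <;> simp [hu, hEn]
  have hune : ∀ i, u i ≠ 0 := fun i h0 ↦ by simpa [h0] using hun i
  have husucc : ∀ i, u (i + 1) = u i * E (i + 1) := by
    intro i
    fin_cases i
    · simp [hu]
    · simp [hu]
    · simp [hu]
    · simp [hu]
    · exact hprod.symm
  have husucc' : ∀ i, u (i + 1) = -u i * Complex.exp (-(a (i + 1) * Complex.I)) := by
    intro i
    rw [husucc, hE]
    ring
  set t : Fin 5 → ℝ := fun i ↦ Real.cot (a i / 2) with ht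
  have htpos : ∀ i, 0 < t i := fun i ↦
    cot_pos (by linarith [(ha i).1]) (by linarith [(ha i).2])
  have hS : 0 < ∑ i, t i := Finset.sum_pos (fun i _ ↦ htpos i) ⟨0, by simp⟩
  -- Inradius `s` gives area s² ∑ t i.
  set s : ℝ := 1 / √(∑ i, t i) with hs
  have hspos : 0 < s := by positivity
  set P : Polygon ℂ 5 := ⟨fun i ↦ 0 + s * (-(Complex.I + t i) * u i)⟩ with hP
  have hedge : ∀ i, P (i + 1) - P i = ((s * (t i + t (i + 1)) : ℝ) : ℂ) * u i := by
    intro i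
    have := cot_half_mul_eq (ha (i + 1)) (husucc' i)
    simp only [hP, ht]
    push_cast
    push_cast at this
    linear_combination -Complex.I * s * this -
      s * Complex.cot (a (i + 1) / 2) * (u (i + 1) + u i) * Complex.I_sq
  have hlen : ∀ i, 0 < s * (t i + t (i + 1)) := fun i ↦
    mul_pos hspos (add_pos (htpos _) (htpos _))
  have hang' : ∀ i, interiorAngle P (i + 1) = a (i + 1) := by
    intro i
    have e' := hedge (i + 1)
    have l' := hlen (i + 1)
    simp only [add_assoc, Fin.reduceAdd] at e' l'
    exact interiorAngle_eq_of_edges (hlen i) l' (ha _) (hune i) (husucc' i) (hedge i) e'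
  have hang : interiorAngle P = a := by
    funext i
    have := hang' (i - 1)
    rwa [sub_add_cancel] at this
  have hconv : LocallyConvex P := by
    rw [locallyConvex_iff, hang]
    exact ha
  have hdir : ∀ i, dir P i = u i := by
    intro i
    have hd : dist (P i) (P (i + 1)) = s * (t i + t (i + 1)) := by
      rw [dist_comm, dist_eq_norm, hedge, norm_mul, hun, Complex.norm_real, mul_one,
        Real.norm_eq_abs, abs_of_pos (hlen i)]
    have hne : ((s * (t i + t (i + 1)) : ℝ) : ℂ) ≠ 0 := by exact_mod_cast (hlen i).ne'
    rw [dir, hd, hedge, mul_div_cancel_left₀ _ hne]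
  have hcot : cotHalf P = t := by
    funext i
    rw [cotHalf, hang]
  have htan : ∀ i, P i = 0 + s * tangential P i := by
    intro i
    rw [tangential, hdir, hcot]
  refine ⟨P, ⟨hconv.isSimple (by rw [hang]; exact hpair), ?_⟩,
    hconv.isCircumscribed_of_eq_tangential hspos htan, hang⟩
  rw [(hconv.perimeter_area_of_eq_tangential hspos htan).2, hcot, hs, div_pow, one_pow,
    Real.sq_sqrt hS.le, one_div_mul_cancel hS.ne']

/-! ### Characterization of the minimizers -/

/-- The angles of the minimizer. -/
noncomputable def minAngles : Multiset ℝ :=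
  {Real.pi / 2, 3 * Real.pi / 5, 3 * Real.pi / 5, 3 * Real.pi / 5, 7 * Real.pi / 10}

lemma exists_minimizing_pentagon : ∃ P : Polygon ℂ 5, IsUnitPentagon P ∧ IsCircumscribed P ∧
    Multiset.map (interiorAngle P) Finset.univ.val = minAngles := by
  have hπ := Real.pi_pos
  obtain ⟨P, h1, h2, h3⟩ := exists_circumscribed
    (a := ![Real.pi / 2, 3 * Real.pi / 5, 3 * Real.pi / 5, 3 * Real.pi / 5, 7 * Real.pi / 10])
    (by intro i; fin_cases i <;> constructor <;> simp <;> linarith)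
    (by rw [Fin.sum_univ_five]; simp; ring)
    (by intro i; fin_cases i <;> simp <;> linarith)
  exact ⟨P, h1, h2, by rw [h3]; rfl⟩

/-- The perimeter bound for competitors, with its case of equality. -/
lemma IsCompetitor.four_mul_minCotSum_le {P : Polygon ℂ 5} (hP : IsCompetitor P) :
    4 * minCotSum ≤ perimeter P ^ 2 ∧ (perimeter P ^ 2 = 4 * minCotSum →
      IsCircumscribed P ∧ Multiset.map (interiorAngle P) Finset.univ.val = minAngles) := by
  by_cases h : LocallyConvex P
  · have hsum := h.sum_interiorAngle hP.simple
    have hl := h.lhuilier hsum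
    obtain ⟨hmin, heq⟩ := minCotSum_le (locallyConvex_iff.1 h) hsum hP.tiles hP.tiles_four
    change minCotSum ≤ ∑ i, cotHalf P i at hmin
    rw [hP.area, mul_one] at hl
    refine ⟨by linarith, fun he ↦ ?_⟩
    obtain ⟨c, s, hs, hcs⟩ := h.eq_tangential_of_lhuilier_eq hsum
      (by rw [hP.area, mul_one]; linarith)
    refine ⟨h.isCircumscribed_of_eq_tangential hs hcs, heq ?_⟩
    change ∑ i, cotHalf P i = minCotSum
    linarith
  · simp only [LocallyConvex, not_forall, not_lt] at h
    obtain ⟨k, hk⟩ := h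
    have h4 := four_le_perimeter hP.area hk
    have hT := minCotSum_bounds.2
    have : 16 ≤ perimeter P ^ 2 := by nlinarith
    exact ⟨by linarith, fun he ↦ by linarith⟩

/-- The tilings are 4 · π/2 = 2π and 3π/5 + 2 · 7π/10 = 2π. The perimeter follows from L = 2sS and A
= s²S for inradius s and cotangent sum S. -/
lemma isCompetitor_of_angles {P : Polygon ℂ 5} (hP : IsUnitPentagon P) (hc : IsCircumscribed P)
    (ha : Multiset.map (interiorAngle P) Finset.univ.val = minAngles) :
    IsCompetitor P ∧ perimeter P ^ 2 = 4 * minCotSum := by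
  have hπ := Real.pi_pos
  have hmem : ∀ i, interiorAngle P i = Real.pi / 2 ∨ interiorAngle P i = 3 * Real.pi / 5 ∨
      interiorAngle P i = 7 * Real.pi / 10 := by
    intro i
    have : interiorAngle P i ∈ minAngles := by
      rw [← ha]
      exact Multiset.mem_map_of_mem _ (Finset.mem_univ i)
    simp only [minAngles, Multiset.insert_eq_cons, Multiset.mem_cons, Multiset.mem_singleton]
      at this
    tauto
  have hex : ∀ x ∈ minAngles, ∃ i, interiorAngle P i = x := by
    intro x hx
    rw [← ha] at hx
    obtain ⟨i, -, hi⟩ := Multiset.mem_map.1 hx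
    exact ⟨i, hi⟩
  obtain ⟨i₁, h₁⟩ := hex (Real.pi / 2) (by simp [minAngles])
  obtain ⟨i₂, h₂⟩ := hex (3 * Real.pi / 5) (by simp [minAngles])
  obtain ⟨i₃, h₃⟩ := hex (7 * Real.pi / 10) (by simp [minAngles])
  have hconv : LocallyConvex P := by
    rw [locallyConvex_iff]
    intro i
    rcases hmem i with h | h | h <;> rw [h] <;> constructor <;> linarith
  have hsumcot : ∑ i, cotHalf P i = minCotSum := by
    have h := congrArg (fun m ↦ (Multiset.map (fun x ↦ Real.cot (x / 2)) m).sum) ha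
    simp only [Multiset.map_map, minAngles, Multiset.insert_eq_cons, Multiset.map_cons,
      Multiset.sum_cons, Multiset.map_singleton, Multiset.sum_singleton] at h
    have h1 : Real.cot (Real.pi / 2 / 2) = 1 := by
      rw [show Real.pi / 2 / 2 = Real.pi / 4 by ring, Real.cot_eq_cos_div_sin,
        Real.cos_pi_div_four, Real.sin_pi_div_four, div_self (by positivity)]
    rw [h1, show 3 * Real.pi / 5 / 2 = 3 * Real.pi / 10 by ring,
      show 7 * Real.pi / 10 / 2 = 7 * Real.pi / 20 by ring] at h
    refine Eq.trans h ?_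
    rw [minCotSum]; ring
  have hright : ∀ i, interiorAngle P i = Real.pi / 2 →
      AngleTilesDegreeFour (interiorAngle P) i := by
    intro i hi
    refine ⟨Pi.single i 4, by simp, by simp, ?_⟩
    rw [Finset.sum_eq_single i (fun j _ hj ↦ by simp [hj]) (by simp), hi]
    simp; ring
  have hthree : ∀ i j, interiorAngle P i = 3 * Real.pi / 5 → interiorAngle P j = 7 * Real.pi / 10 →
      ∑ k, ((Pi.single i 1 + Pi.single j 2 : Fin 5 → ℕ) k : ℝ) * interiorAngle P k =
        2 * Real.pi := by
    intro i j hi hj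
    simp only [Pi.add_apply, Nat.cast_add, add_mul, Finset.sum_add_distrib]
    rw [Finset.sum_eq_single i (fun k _ hk ↦ by simp [hk]) (by simp),
      Finset.sum_eq_single j (fun k _ hk ↦ by simp [hk]) (by simp), hi, hj]
    simp; ring
  refine ⟨⟨hP, fun j ↦ ?_, i₁, hright i₁ h₁⟩, ?_⟩
  · rcases hmem j with h | h | h
    · obtain ⟨m, hm, -, hm'⟩ := hright j h
      exact ⟨m, hm, hm'⟩
    · exact ⟨_, by simp, hthree j i₃ h h₃⟩
    · exact ⟨_, by simp, hthree i₂ j h₂ h⟩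
  · obtain ⟨c, s, hs, hcs⟩ := hconv.exists_eq_tangential hc
    obtain ⟨hL, hA⟩ := hconv.perimeter_area_of_eq_tangential hs hcs
    rw [hP.area] at hA
    rw [hsumcot] at hL hA
    rw [hL]
    linear_combination -4 * minCotSum * hA

lemma perimeter_nonneg (P : Polygon ℂ 5) : 0 ≤ perimeter P :=
  Finset.sum_nonneg fun _ _ ↦ dist_nonneg

lemma isPerimeterMinimizer_iff {P : Polygon ℂ 5} :
    IsPerimeterMinimizer P ↔ IsCompetitor P ∧ perimeter P ^ 2 = 4 * minCotSum := by
  constructor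
  · intro h
    obtain ⟨Q, h1, h2, h3⟩ := exists_minimizing_pentagon
    obtain ⟨hQ, hQ'⟩ := isCompetitor_of_angles h1 h2 h3
    have hle := pow_le_pow_left₀ (perimeter_nonneg P) (h.le_perimeter Q hQ) 2
    exact ⟨h.toIsCompetitor, le_antisymm (hle.trans_eq hQ')
      h.toIsCompetitor.four_mul_minCotSum_le.1⟩
  · rintro ⟨h, he⟩
    refine ⟨h, fun Q hQ ↦ ?_⟩
    exact le_of_sq_le_sq (he.trans_le hQ.four_mul_minCotSum_le.1) (perimeter_nonneg Q)

end PentagonTiling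

open PentagonTiling in
theorem proposition2p15 :
    (∃ P : Polygon ℂ 5, IsPerimeterMinimizer P) ∧
    (∀ P : Polygon ℂ 5, IsPerimeterMinimizer P ↔
      IsUnitPentagon P ∧ IsCircumscribed P ∧
        Multiset.map (interiorAngle P) Finset.univ.val =
          {Real.pi / 2, 3 * Real.pi / 5, 3 * Real.pi / 5, 3 * Real.pi / 5, 7 * Real.pi / 10}) ∧
    (∀ P : Polygon ℂ 5, IsPerimeterMinimizer P → |perimeter P - 3.8414| < 0.00005) := by
  refine ⟨?_, fun P ↦ ⟨fun h ↦ ?_, fun h ↦ ?_⟩, fun P h ↦ ?_⟩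
  · obtain ⟨P, h1, h2, h3⟩ := exists_minimizing_pentagon
    exact ⟨P, isPerimeterMinimizer_iff.2 (isCompetitor_of_angles h1 h2 h3)⟩
  · obtain ⟨hc, he⟩ := isPerimeterMinimizer_iff.1 h
    exact ⟨hc.toIsUnitPentagon, hc.four_mul_minCotSum_le.2 he⟩
  · exact isPerimeterMinimizer_iff.2 (isCompetitor_of_angles h.1 h.2.1 h.2.2)
  · have he := (isPerimeterMinimizer_iff.1 h).2
    have hT := minCotSum_bounds
    have hp := perimeter_nonneg P
    have h1 : 3.84135 < perimeter P := by
      apply lt_of_pow_lt_pow_left₀ 2 hp; rw [he]; norm_num; linarith [hT.1]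
    -- Since 3.84145²/4 ≈ 3.68918, the upper estimate in `minCotSum_bounds` has little slack.
    have h2 : perimeter P < 3.84145 := by
      apply lt_of_pow_lt_pow_left₀ 2 (by norm_num); rw [he]; norm_num; linarith [hT.2]
    rw [abs_lt]
    constructor <;> linarith
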